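/- **Conventions.** Graded Lie algebras are $\mathbb Z$-graded with a bracket of degree $0$ satisfying graded antisymmetry and the graded Jacobi identity. A DGLA is a graded Lie algebra $\mathfrak g$ with a derivation $\partial$ of degree $1$ and $\partial^2=0$; $\partial$ is *outer* if it is not of the form $[D,\cdot]$ with $D\in\mathfrak g^1$. A (graded) *Harish-Chandra pair* $(G_0,\mathfrak g,\alpha)$ consists of a real finite-dimensional Lie group $G_0$, a real graded Lie algebra $\mathfrak g=\bigoplus_{i\ge 0}\mathfrak g_i$ with finite-dimensional homogeneous components and $\mathfrak g_0=\mathrm{Lie}(G_0)$, and a smooth degree-preserving representation $\alpha$ of $G_0$ on $\mathfrak g$ by automorphisms of the graded Lie algebra, which restricts to $\mathrm{Ad}$ on $\mathfrak g_0$ and whose differential at $e$ is the adjoint action of $\mathfrak g_0$ on $\mathfrak g$. If $\mathfrak g$ is a DGLA with differential $\partial$, a *1-cocycle* of the differential graded pair is a smooth map $\lambda:G_0\to\mathfrak g^1$ with $\lambda(gh)=\lambda(g)+\alpha(g)\lambda(h)$ and $\mathrm{ad}\,\lambda(g)=\alpha(g)\,\partial\,\alpha(g)^{-1}-\partial$ for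 all $g,h\in G_0$. **Lemma.** 1. Let $\mathfrak g$ be a DGLA over a field $k$ of characteristic $0$ with an outer differential $\partial$. Then $\tilde{\mathfrak g}=\mathfrak g\oplus k\partial$ carries one and only one DGLA structure such that $\mathfrak g$ is a graded Lie subalgebra, $\partial$ has degree $1$, $[\partial,\partial]=2\partial^2=0$, $[\partial,x]=\partial(x)$ for all $x\in\mathfrak g$, and the differential of $\tilde{\mathfrak g}$ is $\mathrm{ad}\,\partial=[\partial,\cdot]$. Let now $k=\mathbb R$ and let $(G_0,\mathfrak g,\alpha)$ be a Harish-Chandra pair, where $\mathfrak g$ is a DGLA with an outer differential $\partial$, and let $\tilde{\mathfrak g}$ be as in 1. By an *extension* of $\alpha$ to $\tilde{\mathfrak g}$ we mean a smooth degree-preserving representation $\tilde\alpha$ of $G_0$ on $\tilde{\mathfrak g}$ that restricts to $\alpha$ on $\mathfrak g$ and is compatible with the conjugation action of $G_0$ on derivations of $\mathfrak g$, i.e. $[\tilde\alpha(g)a,x]=\tilde\alpha(g)[a,\alpha(g)^{-1}x]$ for all $a\in\tilde{\mathfrak g}$, $x\in\mathfrak g$, $g\in G_0$. 2. The formula $\tilde\alpha(g)\partial=\partial+\lambda(g)$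 defines a bijection between the 1-cocycles $\lambda$ and the extensions $\tilde\alpha$ of $\alpha$ to $\tilde{\mathfrak g}$ that act trivially on $\tilde{\mathfrak g}/\mathfrak g$. If $G_0$ is connected, every extension acts trivially on $\tilde{\mathfrak g}/\mathfrak g$, so the bijection is with all extensions. Under this bijection, $\tilde\alpha$ acts by automorphisms of the graded Lie algebra $\tilde{\mathfrak g}$ if and only if $\partial\lambda(g)+\tfrac12[\lambda(g),\lambda(g)]=0$ for all $g\in G_0$; and $(G_0,\tilde{\mathfrak g},\tilde\alpha)$ is a Harish-Chandra pair if and only if, in addition, $d_e\lambda(X)=-\partial X$ for all $X\in\mathfrak g_0$. 3. If $G_0$ is simply connected (in particular connected), there is exactly one representation $\tilde\alpha$ of $G_0$ on $\tilde{\mathfrak g}$ that restricts to $\alpha$ on $\mathfrak g$ and makes $(G_0,\tilde{\mathfrak g},\tilde\alpha)$ into a Harish-Chandra pair (the extended Harish-Chandra pair). -/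

import Mathlib

open scoped Manifold ContDiff

/-- A graded Lie algebra over `k` on the vector space `L`: a `ℤ`-grading `L = ⨁ gr i` with a
bilinear bracket of degree `0` that is graded antisymmetric and satisfies the graded Jacobi
identity. -/
structure GLieAlgebra (k L : Type*) [Field k] [AddCommGroup L] [Module k L] where
  gr : ℤ → Submodule k L
  isInternal : DirectSum.IsInternal gr
  bracket : L →ₗ[k] L →ₗ[k] L
  bracket_mem : ∀ {i j : ℤ} {x y : L}, x ∈ gr i → y ∈ gr j → bracket x y ∈ gr (i + j)
  antisymm : ∀ {i j : ℤ} {x y : L}, x ∈ gr i → y ∈ gr j →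
    bracket x y = -((i * j).negOnePow • bracket y x)
  jacobi : ∀ {i j : ℤ} {x y : L}, x ∈ gr i → y ∈ gr j → ∀ z : L,
    bracket x (bracket y z) =
      bracket (bracket x y) z + (i * j).negOnePow • bracket y (bracket x z)

/-- A differential graded Lie algebra: a graded Lie algebra with a derivation `d` of degree `1`
and square zero. -/
structure DGLieAlgebra (k L : Type*) [Field k] [AddCommGroup L] [Module k L] extends
    GLieAlgebra k L where
  d : L →ₗ[k] L
  d_mem : ∀ {i : ℤ} {x : L}, x ∈ gr i → d x ∈ gr (i + 1)
  d_bracket : ∀ {i : ℤ} {x : L}, x ∈ gr i → ∀ y : L,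
    d (bracket x y) = bracket (d x) y + i.negOnePow • bracket x (d y)
  d_d : ∀ x : L, d (d x) = 0

/-- The differential is outer: it is not the inner derivation `[D, ·]` of an element `D` of
degree `1`. -/
def DGLieAlgebra.IsOuter {k L : Type*} [Field k] [AddCommGroup L] [Module k L]
    (𝔤 : DGLieAlgebra k L) : Prop :=
  ¬ ∃ D ∈ 𝔤.gr 1, ∀ x : L, 𝔤.d x = 𝔤.bracket D x

/-- `𝔥` is a DGLA structure on `L ⊕ k∂` (realised as `L × k`, with `L` embedded by `x ↦ (x, 0)` and
`∂ = (0, 1)`) such that `L` is a graded Lie subalgebra, `∂` has degree `1`, `∂² = 0` (that is,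
`[∂, ∂] = 2∂² = 0`), `[∂, x] = ∂(x)` for `x` in `L`, and the differential is `[∂, ·]`. -/
structure DGLieAlgebra.IsExtension {k L : Type*} [Field k] [AddCommGroup L] [Module k L]
    (𝔤 : DGLieAlgebra k L) (𝔥 : DGLieAlgebra k (L × k)) : Prop where
  incl_mem : ∀ {i : ℤ} {x : L}, x ∈ 𝔤.gr i → ((x, 0) : L × k) ∈ 𝔥.gr i
  partial_mem : ((0, 1) : L × k) ∈ 𝔥.gr 1
  bracket_incl : ∀ x y : L, 𝔥.bracket (x, 0) (y, 0) = (𝔤.bracket x y, 0)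
  bracket_partial_partial : 𝔥.bracket (0, 1) (0, 1) = 0
  bracket_partial_incl : ∀ x : L, 𝔥.bracket (0, 1) (x, 0) = (𝔤.d x, 0)
  d_eq : ∀ a : L × k, 𝔥.d a = 𝔥.bracket (0, 1) a

section LieGroup

variable {E : Type*} [NormedAddCommGroup E] [NormedSpace ℝ E]
  {G : Type*} [TopologicalSpace G] [ChartedSpace E G]
  {V : Type*} [AddCommGroup V] [Module ℝ V]

/-- Smoothness of a map from a manifold into a real vector space, tested on linear functionals.
For maps into a finite-dimensional (subspace of a) vector space, the only case in which it is used,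
this is smoothness for the standard manifold structure of a finite-dimensional space: see
`smoothMap_iff_contMDiff`. -/
def SmoothMap (E : Type*) [NormedAddCommGroup E] [NormedSpace ℝ E] {G : Type*} [TopologicalSpace G]
    [ChartedSpace E G] {V : Type*} [AddCommGroup V] [Module ℝ V] (f : G → V) : Prop :=
  ∀ φ : Module.Dual ℝ V, ContMDiff 𝓘(ℝ, E) 𝓘(ℝ, ℝ) ∞ (fun g => φ (f g))

theorem smoothMap_iff_contMDiff {W : Type*} [NormedAddCommGroup W] [NormedSpace ℝ W]
    [FiniteDimensional ℝ W] (f : G → W) :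
    SmoothMap E f ↔ ContMDiff 𝓘(ℝ, E) 𝓘(ℝ, W) ∞ f := by
  constructor
  · intro h
    let b := Module.finBasis ℝ W
    have hf : f = fun g => ∑ i, b.coord i (f g) • b i := by
      funext g
      exact (b.sum_repr (f g)).symm
    rw [hf]
    exact contMDiff_finsetSum fun i _ => (h (b.coord i)).smul contMDiff_const
  · intro h φ
    exact (LinearMap.toContinuousLinearMap φ).contMDiff.comp h

variable [Group G]

/-- The derivative at the identity, in the direction `X`, of the map `f` from the Lie group `G` into
a real vector space is `v` (tested on linear functionals; used for smooth `f` only). -/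
def DerivAtOneEq (f : G → V) (X : GroupLieAlgebra 𝓘(ℝ, E) G) (v : V) : Prop :=
  ∀ φ : Module.Dual ℝ V, mfderiv 𝓘(ℝ, E) 𝓘(ℝ, ℝ) (fun g => φ (f g)) (1 : G) X = φ v

/-- The adjoint representation of `G`: `Ad g` is the derivative at `1` of `h ↦ g * h * g⁻¹`. -/
noncomputable def lieGroupAd (g : G) (X : GroupLieAlgebra 𝓘(ℝ, E) G) :
    GroupLieAlgebra 𝓘(ℝ, E) G :=
  (mfderiv 𝓘(ℝ, E) 𝓘(ℝ, E) (fun h : G => g * h * g⁻¹) (1 : G) X : E)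

/-- `(G, 𝔤, α)` is a (non-negatively graded) graded Harish-Chandra pair: `𝔤` is a non-negatively
graded Lie algebra with finite-dimensional homogeneous components, its degree `0` part is
identified with the Lie algebra of `G` by `ι`, and `α` is a smooth degree-preserving representation
of `G` on `𝔤` by automorphisms of the graded Lie algebra, which induces the adjoint
representation on the degree `0` part and whose differential at the identity is `ad`. -/
structure IsHarishChandraPair (𝔤 : GLieAlgebra ℝ V)
    (ι : GroupLieAlgebra 𝓘(ℝ, E) G →ₗ[ℝ] V) (α : Representation ℝ G V) : Prop where
  nonneg : ∀ i : ℤ, i < 0 → 𝔤.gr i = ⊥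
  finiteDimensional : ∀ i : ℤ, FiniteDimensional ℝ (𝔤.gr i)
  ι_injective : Function.Injective ι
  ι_range : LinearMap.range ι = 𝔤.gr 0
  ι_bracket : ∀ X Y : GroupLieAlgebra 𝓘(ℝ, E) G, ι ⁅X, Y⁆ = 𝔤.bracket (ι X) (ι Y)
  map_mem : ∀ (g : G) {i : ℤ} {x : V}, x ∈ 𝔤.gr i → α g x ∈ 𝔤.gr i
  map_bracket : ∀ (g : G) (x y : V), α g (𝔤.bracket x y) = 𝔤.bracket (α g x) (α g y)
  smooth : ∀ x : V, SmoothMap E (fun g => α g x)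
  adjoint : ∀ (g : G) (X : GroupLieAlgebra 𝓘(ℝ, E) G), α g (ι X) = ι (lieGroupAd g X)
  differential : ∀ (X : GroupLieAlgebra 𝓘(ℝ, E) G) (x : V),
    DerivAtOneEq (fun g => α g x) X (𝔤.bracket (ι X) x)

/-- The `1`-cocycles of a differential graded Harish-Chandra pair: smooth maps `lam : G → 𝔤¹` with
`lam (g h) = lam g + α g (lam h)` and `ad (lam g) = α g ∘ d ∘ (α g)⁻¹ - d`. -/
structure IsDGCocycle (E : Type*) [NormedAddCommGroup E] [NormedSpace ℝ E] {G : Type*}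
    [TopologicalSpace G] [ChartedSpace E G] [Group G] {V : Type*} [AddCommGroup V] [Module ℝ V]
    (𝔤 : DGLieAlgebra ℝ V) (α : Representation ℝ G V) (lam : G → V) : Prop where
  mem : ∀ g : G, lam g ∈ 𝔤.gr 1
  smooth : SmoothMap E lam
  cocycle : ∀ g h : G, lam (g * h) = lam g + α g (lam h)
  bracket_eq : ∀ (g : G) (x : V), 𝔤.bracket (lam g) x = α g (𝔤.d (α g⁻¹ x)) - 𝔤.d x

/-- `β` extends `α` to `𝔥 = 𝔤 ⊕ ℝ∂`: it is a smooth degree-preserving representation of `G` which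
restricts to `α` on `𝔤` and extends the conjugation action of `G` on derivations of `𝔤`, i.e. the
action `a ↦ [a, ·]` of `𝔥` on the ideal `𝔤` satisfies `[β g a, ·] = α g ∘ [a, ·] ∘ (α g)⁻¹`. -/
structure IsExtendedAction (E : Type*) [NormedAddCommGroup E] [NormedSpace ℝ E] {G : Type*}
    [TopologicalSpace G] [ChartedSpace E G] [Group G] {V : Type*} [AddCommGroup V] [Module ℝ V]
    (𝔥 : GLieAlgebra ℝ (V × ℝ)) (α : Representation ℝ G V)
    (β : Representation ℝ G (V × ℝ)) : Prop where
  restrict : ∀ (g : G) (x : V), β g (x, 0) = (α g x, 0)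
  map_mem : ∀ (g : G) {i : ℤ} {a : V × ℝ}, a ∈ 𝔥.gr i → β g a ∈ 𝔥.gr i
  smooth : ∀ a : V × ℝ, SmoothMap E (fun g => β g a)
  equivariant : ∀ (g : G) (a : V × ℝ) (x : V),
    𝔥.bracket (β g a) (x, 0) = β g (𝔥.bracket a (α g⁻¹ x, 0))

end LieGroup

/-!
A differential graded Lie algebra `𝔤` with outer differential is enlarged to `𝔤 ⊕ ℝ∂`, and a
Harish-Chandra pair `(G, 𝔤, α)` to a pair with Lie algebra `𝔤 ⊕ ℝ∂`.

*The extension.* The conditions prescribe `[x, y]`, `[∂, x] = d x` and `[∂, ∂] = 0`, and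
antisymmetry forces `[x, ∂] = -(-1)ⁱ d x` in degree `i`; also a grading is determined by lower bounds
on its components. This is uniqueness (`DGLieAlgebra.IsExtension.eq_ext`), and the bracket so defined
satisfies the Jacobi identity because `d` is a derivation of square zero
(`DGLieAlgebra.isExtension_ext`).

*Cocycles and actions.* A representation on `𝔤 ⊕ ℝ∂` that extends `α` and is trivial on the quotient
is given by `lam g = g ∂ - ∂`; multiplicativity is the cocycle identity, and equivariance of the
action on `𝔤` by derivations is the formula for `ad (lam g)` (`cocycleEquivExtendedAction`). Brackets
are respected up to the curvature `d (lam g) + ½ [lam g, lam g]`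
(`IsDGCocycle.bracket_extendByCocycle`), and the differential of the action is `ad` exactly when that
of `lam` is `-d`.

*Connected groups.* The group acts on the quotient `ℝ∂` by a character. Differentiating the
equivariance at the identity shows that the derivative of the character, times `d`, is an inner
derivation; as `d` is outer, the derivative vanishes and the character is trivial
(`IsExtendedAction.hasDerivAtOne_snd`).

*Simply connected groups.* The linear map `X ↦ -d X` is a `1`-cocycle of the Lie algebra of `G` with
values in `𝔤¹`, and has to be integrated to a group cocycle
(`exists_group_cocycle_of_lie_cocycle`). The one-form on `G` whose value on the left-invariant
field of `X` is `g ↦ -α g (d X)` is closed, so by the Poincaré lemma it has a primitive near the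
identity (`exists_primitive_near_one`). The left translates of this primitive, twisted by the
action, are primitives near the other points; they differ by locally constant functions and glue
because `G` is simply connected (`exists_eventually_sub_eq_of_simplyConnectedSpace`). The remaining
identities, namely the cocycle identity, the formula for `ad (lam g)`, the vanishing of the curvature,
and the uniqueness of the extension, all follow from one principle: a map on a connected group whose
derivatives along all left-invariant fields vanish is constant
(`eq_one_of_hasDerivAtOne_mul_left_zero`).
-/

open Topology Filter

/-! ### Gluing on simply connected spaces -/

/-- Gluing of local functions whose differences are locally constant: on a simply connected space
there is a global function which differs from each `F b` on `U b` by a locally constant function.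
The `F b - F c` are the transition functions of a covering with fibre the discrete group `W`, and a
global section of this covering, which exists since the base is simply connected, corrects the
`F b` to a single function. -/
theorem exists_eventually_sub_eq_of_simplyConnectedSpace {X W : Type*} [TopologicalSpace X]
    [SimplyConnectedSpace X] [LocallyPathConnectedSpace X] [AddCommGroup W] (U : X → Set X)
    (hU : ∀ b, IsOpen (U b)) (hmem : ∀ b, b ∈ U b) (F : X → X → W)
    (hF : ∀ b c, ∀ x ∈ U b ∩ U c, ∀ᶠ y in 𝓝 x, F b y - F c y = F b x - F c x) :
    ∃ f : X → W, ∀ b, ∀ x ∈ U b, ∀ᶠ y in 𝓝 x, f y - F b y = f x - F b x := by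
  -- discrete fibres make the bundle a covering
  let _ : TopologicalSpace W := ⊥
  have : DiscreteTopology W := ⟨rfl⟩
  let Z : FiberBundleCore X X W :=
    { baseSet := U
      isOpen_baseSet := hU
      indexAt := id
      mem_baseSet_at := hmem
      coordChange := fun b c x w => w + (F b x - F c x)
      coordChange_self := by simp
      continuousOn_coordChange := by
        intro b c
        refine continuous_snd.continuousOn.add ?_
        rintro ⟨x, w⟩ ⟨hx, -⟩
        refine ContinuousAt.continuousWithinAt ?_
        have : ContinuousAt (fun y : X => F b y - F c y) x :=
          (continuousAt_const (y := F b x - F c x)).congr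
            ((hF b c x hx).mono fun y hy => hy.symm)
        exact ContinuousAt.comp (f := Prod.fst) (x := (x, w)) this continuousAt_fst
      coordChange_comp := by
        intro b c d x _ w
        abel }
  have hcov : IsCoveringMap Z.proj :=
    IsCoveringMap.mk _ (fun _ => W) (fun x => Z.localTriv x) (fun x => hmem x)
  obtain ⟨a⟩ : Nonempty X := inferInstance
  obtain ⟨s, ⟨-, hs⟩, -⟩ := hcov.existsUnique_continuousMap_lifts (ContinuousMap.id X) a
    ⟨a, (0 : W)⟩ rfl
  have hs1 : ∀ x, (s x).1 = x := fun x => congrFun hs x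
  let v : Z.TotalSpace → W := fun p => p.2
  refine ⟨fun x => v (s x) + F x x, fun b x hx => ?_⟩
  -- the coordinate of the section in the trivialisation over `U b` is locally constant
  have hcont : ContinuousAt (fun y => (Z.localTriv b (s y)).2) x := by
    have h1 : ContinuousAt (Z.localTriv b) (s x) :=
      (Z.localTriv b).continuousAt ((Z.localTriv b).mem_source.2 (by
        change (s x).1 ∈ U b
        rw [hs1]; exact hx))
    exact (continuousAt_snd.comp h1).comp s.continuous.continuousAt
  have hval : ∀ y, (Z.localTriv b (s y)).2 = v (s y) + F y y - F b y := by
    intro y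
    change v (s y) + (F (s y).1 (s y).1 - F b (s y).1) = _
    rw [hs1, add_sub_assoc]
  have := hcont.eventually_mem ((isOpen_discrete {(Z.localTriv b (s x)).2}).mem_nhds rfl)
  filter_upwards [this] with y hy
  have hy' : (Z.localTriv b (s y)).2 = (Z.localTriv b (s x)).2 := hy
  rw [hval, hval] at hy'
  exact hy'

/-! ### Functions with zero derivative -/

section ZeroDeriv

variable {E : Type*} [NormedAddCommGroup E] [NormedSpace ℝ E]
  {F : Type*} [NormedAddCommGroup F] [NormedSpace ℝ F]

/-- A function on a manifold without boundary whose derivative vanishes near `x` is constant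
near `x`. -/
theorem eventually_eq_of_eventually_hasMFDerivAt_zero {M : Type*} [TopologicalSpace M]
    [ChartedSpace E M] [IsManifold 𝓘(ℝ, E) 1 M] {f : M → F} {x : M}
    (hf : ∀ᶠ y in 𝓝 x, HasMFDerivAt 𝓘(ℝ, E) 𝓘(ℝ, F) f y 0) : ∀ᶠ y in 𝓝 x, f y = f x := by
  set φ := extChartAt 𝓘(ℝ, E) x with hφ
  have hT : φ.target ∈ 𝓝 (φ x) := extChartAt_target_mem_nhds x
  have hψ : ContinuousAt φ.symm (φ x) := continuousAt_extChartAt_symm x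
  have h1 : ∀ᶠ z in 𝓝 (φ x), HasMFDerivAt 𝓘(ℝ, E) 𝓘(ℝ, F) f (φ.symm z) 0 := by
    refine hψ.eventually (p := fun y => HasMFDerivAt 𝓘(ℝ, E) 𝓘(ℝ, F) f y 0) ?_
    rwa [extChartAt_to_inv]
  obtain ⟨r, hr, hball⟩ := Metric.mem_nhds_iff.1 (h1.and hT)
  have h2 : ∀ z ∈ Metric.ball (φ x) r, HasFDerivAt (f ∘ φ.symm) (0 : E →L[ℝ] F) z := by
    intro z hz
    obtain ⟨ha, hb⟩ := hball hz
    have hs : MDifferentiableAt 𝓘(ℝ, E) 𝓘(ℝ, E) φ.symm z :=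
      ((contMDiffOn_extChartAt_symm (n := 1) x).contMDiffAt
        ((isOpen_extChartAt_target x).mem_nhds hb)).mdifferentiableAt one_ne_zero
    have := ha.comp z hs.hasMFDerivAt
    rw [hasMFDerivAt_iff_hasFDerivAt] at this
    have h0 : (0 : E →L[ℝ] F) =
        (0 : E →L[ℝ] F).comp (mfderiv 𝓘(ℝ, E) 𝓘(ℝ, E) φ.symm z : E →L[ℝ] E) := by ext; rfl
    rw [h0]; exact this
  have h3 : ∀ z ∈ Metric.ball (φ x) r, (f ∘ φ.symm) z = (f ∘ φ.symm) (φ x) := by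
    intro z hz
    refine Metric.isOpen_ball.is_const_of_fderiv_eq_zero (𝕜 := ℝ)
      (convex_ball (φ x) r).isPreconnected
      (fun y hy => (h2 y hy).differentiableAt.differentiableWithinAt)
      (fun y hy => (h2 y hy).fderiv) hz (Metric.mem_ball_self hr)
  have h4 : ∀ᶠ y in 𝓝 x, φ y ∈ Metric.ball (φ x) r :=
    (continuousAt_extChartAt x).eventually (Metric.ball_mem_nhds _ hr)
  filter_upwards [h4, extChartAt_source_mem_nhds (I := 𝓘(ℝ, E)) x] with y hy hys
  have := h3 _ hy
  simp only [Function.comp] at this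
  rwa [φ.left_inv hys, extChartAt_to_inv] at this

variable {G : Type*} [TopologicalSpace G] [ChartedSpace E G] [Group G] [LieGroup 𝓘(ℝ, E) ∞ G]

theorem hasMFDerivAt_zero_of_mul_left {f : G → F} {g : G}
    (hf : HasMFDerivAt 𝓘(ℝ, E) 𝓘(ℝ, F) (fun h => f (g * h)) 1 0) :
    HasMFDerivAt 𝓘(ℝ, E) 𝓘(ℝ, F) f g 0 := by
  have h1 : MDifferentiableAt 𝓘(ℝ, E) 𝓘(ℝ, E) (fun h : G => g⁻¹ * h) g :=
    (contMDiff_mul_left (n := ∞)).contMDiffAt.mdifferentiableAt (by simp)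
  have h2 : HasMFDerivAt 𝓘(ℝ, E) 𝓘(ℝ, F) (fun h => f (g * h)) (g⁻¹ * g) 0 := by
    rw [inv_mul_cancel]; exact hf
  have h3 := h2.comp g h1.hasMFDerivAt
  have h4 : (fun h => f (g * h)) ∘ (fun h : G => g⁻¹ * h) = f := by
    funext h; simp
  rw [h4] at h3
  have h0 : (0 : E →L[ℝ] F) = (0 : E →L[ℝ] F).comp
      (mfderiv 𝓘(ℝ, E) 𝓘(ℝ, E) (fun h : G => g⁻¹ * h) g : E →L[ℝ] E) := by ext; rfl
  have h5 : HasMFDerivAt 𝓘(ℝ, E) 𝓘(ℝ, F) f g (0 : E →L[ℝ] F) := by rw [h0]; exact h3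
  exact h5

/-- A map on a connected Lie group is constant if the derivatives at the identity of all its left
translates vanish. -/
theorem eq_one_of_hasMFDerivAt_mul_left_zero [ConnectedSpace G] {f : G → F}
    (hf : ∀ g, HasMFDerivAt 𝓘(ℝ, E) 𝓘(ℝ, F) (fun h => f (g * h)) 1 0) (g : G) : f g = f 1 := by
  have : IsManifold 𝓘(ℝ, E) 1 G := IsManifold.of_le (n := ∞) (by simp)
  have hloc : IsLocallyConstant f := (IsLocallyConstant.iff_eventually_eq f).2 fun x =>
    eventually_eq_of_eventually_hasMFDerivAt_zero
      (Eventually.of_forall fun y => hasMFDerivAt_zero_of_mul_left (hf y))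
  exact hloc.apply_eq_of_preconnectedSpace g 1

end ZeroDeriv

/-! ### Derivatives at the identity of maps into vector spaces -/

section Calculus

variable {E : Type*} [NormedAddCommGroup E] [NormedSpace ℝ E]
  {G : Type*} [TopologicalSpace G] [ChartedSpace E G]
  {V V' : Type*} [AddCommGroup V] [Module ℝ V] [AddCommGroup V'] [Module ℝ V']

theorem SmoothMap.mdifferentiableAt {f : G → V} (hf : SmoothMap E f) (φ : Module.Dual ℝ V) (g : G) :
    MDifferentiableAt 𝓘(ℝ, E) 𝓘(ℝ, ℝ) (fun h => φ (f h)) g :=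
  (hf φ).contMDiffAt.mdifferentiableAt (by simp)

theorem SmoothMap.comp_contMDiff {f : G → V} (hf : SmoothMap E f) {m : G → G}
    (hm : ContMDiff 𝓘(ℝ, E) 𝓘(ℝ, E) ∞ m) : SmoothMap E fun g => f (m g) :=
  fun φ => (hf φ).comp hm

variable [Group G]

/-- `f` is smooth and its derivative at the identity in the direction `X` is `v`. -/
def HasDerivAtOne (f : G → V) (X : GroupLieAlgebra 𝓘(ℝ, E) G) (v : V) : Prop :=
  SmoothMap E f ∧ DerivAtOneEq f X v

variable {X : GroupLieAlgebra 𝓘(ℝ, E) G} {f f₁ f₂ : G → V} {v v₁ v₂ : V}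

theorem HasDerivAtOne.const (x : V) : HasDerivAtOne (fun _ : G => x) X 0 := by
  refine ⟨fun φ => contMDiff_const, fun φ => ?_⟩
  rw [mfderiv_const, map_zero]
  rfl

theorem HasDerivAtOne.add (h₁ : HasDerivAtOne f₁ X v₁) (h₂ : HasDerivAtOne f₂ X v₂) :
    HasDerivAtOne (fun g => f₁ g + f₂ g) X (v₁ + v₂) := by
  refine ⟨fun φ => ?_, fun φ => ?_⟩
  · simp only [map_add]
    exact (h₁.1 φ).add (h₂.1 φ)
  · have h := ((h₁.1.mdifferentiableAt φ 1).hasMFDerivAt.add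
      (h₂.1.mdifferentiableAt φ 1).hasMFDerivAt).mfderiv
    have h' := congrArg (fun L : E →L[ℝ] ℝ => L X) h
    have e : (fun g => φ (f₁ g + f₂ g)) = (fun g => φ (f₁ g)) + fun g => φ (f₂ g) := by
      funext g; exact map_add φ _ _
    rw [e]
    exact (h'.trans (congrArg₂ (fun a b : ℝ => a + b) (h₁.2 φ) (h₂.2 φ))).trans
      (map_add φ _ _).symm

theorem HasDerivAtOne.map (T : V →ₗ[ℝ] V') (h : HasDerivAtOne f X v) :
    HasDerivAtOne (fun g => T (f g)) X (T v) :=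
  ⟨fun φ => h.1 (φ ∘ₗ T), fun φ => h.2 (φ ∘ₗ T)⟩

theorem HasDerivAtOne.neg (h : HasDerivAtOne f X v) : HasDerivAtOne (fun g => -f g) X (-v) :=
  h.map (-LinearMap.id)

theorem HasDerivAtOne.sub (h₁ : HasDerivAtOne f₁ X v₁) (h₂ : HasDerivAtOne f₂ X v₂) :
    HasDerivAtOne (fun g => f₁ g - f₂ g) X (v₁ - v₂) := by
  simpa only [sub_eq_add_neg] using h₁.add h₂.neg

theorem HasDerivAtOne.sum {ι : Type*} (s : Finset ι) {f : ι → G → V} {v : ι → V}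
    (h : ∀ i, HasDerivAtOne (f i) X (v i)) :
    HasDerivAtOne (fun g => ∑ i ∈ s, f i g) X (∑ i ∈ s, v i) := by
  classical
  induction s using Finset.induction_on with
  | empty => simpa using HasDerivAtOne.const (0 : V)
  | insert i s hi ih => simpa only [Finset.sum_insert hi] using (h i).add ih

theorem HasDerivAtOne.smul {a : G → ℝ} {a' : ℝ} (ha : HasDerivAtOne a X a')
    (h : HasDerivAtOne f X v) : HasDerivAtOne (fun g => a g • f g) X (a 1 • v + a' • f 1) := by
  have ha1 : ContMDiff 𝓘(ℝ, E) 𝓘(ℝ, ℝ) ∞ a := ha.1 LinearMap.id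
  have ha2 : mfderiv 𝓘(ℝ, E) 𝓘(ℝ, ℝ) a 1 X = a' := ha.2 LinearMap.id
  refine ⟨fun φ => ?_, fun φ => ?_⟩
  · simp only [map_smul, smul_eq_mul]
    exact ha1.mul (h.1 φ)
  · have h' := ((ha1.contMDiffAt.mdifferentiableAt (by simp)).hasMFDerivAt.mul
      (h.1.mdifferentiableAt φ 1).hasMFDerivAt).mfderiv
    have h'' := congrArg (fun L : E →L[ℝ] ℝ => L X) h'
    have e : (fun g => φ (a g • f g)) = a * fun g => φ (f g) := by
      funext g; exact map_smul φ _ _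
    rw [e]
    refine h''.trans ((congrArg₂ (fun x y : ℝ => a 1 * x + φ (f 1) * y) (h.2 φ) ha2).trans ?_)
    simp only [map_smul, smul_eq_mul, map_add]
    ring

theorem HasDerivAtOne.unique (h₁ : HasDerivAtOne f X v₁) (h₂ : HasDerivAtOne f X v₂) :
    v₁ = v₂ := by
  rw [← sub_eq_zero, ← Module.forall_dual_apply_eq_zero_iff ℝ]
  intro φ
  have := (h₁.2 φ).symm.trans (h₂.2 φ)
  rw [map_sub]
  exact sub_eq_zero.2 this

/-- A linear functional of a smooth map has a derivative. -/
theorem SmoothMap.exists_hasDerivAtOne_dual (hf : SmoothMap E f) (φ : Module.Dual ℝ V)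
    (X : GroupLieAlgebra 𝓘(ℝ, E) G) : ∃ c : ℝ, HasDerivAtOne (fun g => φ (f g)) X c := by
  refine ⟨mfderiv 𝓘(ℝ, E) 𝓘(ℝ, ℝ) (fun g => φ (f g)) 1 X, fun ψ => hf (ψ ∘ₗ φ), fun ψ => ?_⟩
  have h : ∀ x : ℝ, ψ x = ψ 1 * x := fun x => by
    rw [mul_comm, ← smul_eq_mul, ← map_smul, smul_eq_mul, mul_one]
  have h' := ((hasMFDerivAt_const (I := 𝓘(ℝ, E)) (I' := 𝓘(ℝ, ℝ)) (ψ 1) (1 : G)).mul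
      (hf.mdifferentiableAt φ 1).hasMFDerivAt).mfderiv
  have h'' := congrArg (fun L : E →L[ℝ] ℝ => L X) h'
  have h3 : (fun g : G => ψ (φ (f g))) = (fun _ => ψ 1) * fun g => φ (f g) := by
    funext g; exact h _
  rw [h3]
  refine h''.trans (Eq.trans ?_ (h _).symm)
  change ψ 1 * _ + φ (f 1) * (0 : ℝ) = _
  rw [mul_zero, add_zero]
  rfl

/-- A finite-dimensional subspace is the range of a projection `∑ φ i (·) • e i`. -/
theorem Submodule.exists_sum_dual_smul_eq (W : Submodule ℝ V) [FiniteDimensional ℝ W] :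
    ∃ (n : ℕ) (φ : Fin n → Module.Dual ℝ V) (e : Fin n → V), (∀ i, e i ∈ W) ∧
      ∀ x ∈ W, ∑ i, φ i x • e i = x := by
  let b := Module.finBasis ℝ W
  choose φ hφ using fun i => LinearMap.exists_extend (b.coord i)
  refine ⟨_, φ, fun i => b i, fun i => (b i).2, fun x hx => ?_⟩
  have h := congrArg W.subtype (b.sum_repr ⟨x, hx⟩)
  rw [map_sum] at h
  simp only [map_smul] at h
  refine Eq.trans (Finset.sum_congr rfl fun i _ => ?_) h
  exact congrArg (· • (b i : V)) (LinearMap.congr_fun (hφ i) ⟨x, hx⟩)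

variable {W : Submodule ℝ V} [FiniteDimensional ℝ W]

/-- A smooth map into a finite-dimensional subspace has a derivative, which lies in this
subspace. -/
theorem SmoothMap.exists_hasDerivAtOne (hf : SmoothMap E f) (hW : ∀ g, f g ∈ W)
    (X : GroupLieAlgebra 𝓘(ℝ, E) G) : ∃ v ∈ W, HasDerivAtOne f X v := by
  obtain ⟨n, φ, e, he, h⟩ := W.exists_sum_dual_smul_eq
  choose c hc using fun i => hf.exists_hasDerivAtOne_dual (φ i) X
  have h1 := HasDerivAtOne.sum Finset.univ fun i => (hc i).smul (HasDerivAtOne.const (e i))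
  simp only [h _ (hW _), smul_zero, zero_add] at h1
  exact ⟨_, W.sum_mem fun i _ => W.smul_mem _ (he i), h1⟩

theorem HasDerivAtOne.mem (h : HasDerivAtOne f X v) (hW : ∀ g, f g ∈ W) : v ∈ W := by
  obtain ⟨w, hw, h'⟩ := h.1.exists_hasDerivAtOne hW X
  rwa [h.unique h']

/-- Product rule for a family of linear maps `A g` applied to vectors in a finite-dimensional
subspace. -/
theorem HasDerivAtOne.apply {A : G → V →ₗ[ℝ] V'} {A' : V →ₗ[ℝ] V'}
    (hA : ∀ x ∈ W, HasDerivAtOne (fun g => A g x) X (A' x)) (h : HasDerivAtOne f X v)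
    (hW : ∀ g, f g ∈ W) : HasDerivAtOne (fun g => A g (f g)) X (A 1 v + A' (f 1)) := by
  obtain ⟨n, φ, e, he, hs⟩ := W.exists_sum_dual_smul_eq
  have h1 := HasDerivAtOne.sum Finset.univ fun i => (h.map (φ i)).smul (hA (e i) (he i))
  have h2 : ∀ (B : V →ₗ[ℝ] V') (x : V), x ∈ W → ∑ i, φ i x • B (e i) = B x := by
    intro B x hx
    conv_rhs => rw [← hs x hx, map_sum]
    simp only [map_smul]
  simp only [Finset.sum_add_distrib, h2 _ _ (hW _), h2 _ _ (h.mem hW)] at h1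
  rwa [add_comm]

/-- A map on a connected Lie group whose derivatives along all left-invariant vector fields vanish
is constant. -/
theorem eq_one_of_hasDerivAtOne_mul_left_zero [LieGroup 𝓘(ℝ, E) ∞ G] [ConnectedSpace G]
    {f : G → V} (hf : ∀ g X, HasDerivAtOne (E := E) (fun h => f (g * h)) X 0) (g : G) :
    f g = f 1 := by
  rw [← sub_eq_zero, ← Module.forall_dual_apply_eq_zero_iff ℝ]
  intro φ
  rw [map_sub, sub_eq_zero]
  refine eq_one_of_hasMFDerivAt_mul_left_zero (E := E) (f := fun g => φ (f g)) (fun g => ?_) g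
  have h1 := ((hf g 0).1.mdifferentiableAt φ 1).hasMFDerivAt
  have h2 : mfderiv 𝓘(ℝ, E) 𝓘(ℝ, ℝ) (fun h => φ (f (g * h))) 1 = 0 := by
    refine ContinuousLinearMap.ext fun X => ?_
    exact ((hf g X).2 φ).trans (map_zero φ)
  rwa [h2] at h1

end Calculus

/-! ### Gradings and the differential graded Lie algebra `L ⊕ k∂` -/

section Internal

variable {k L M : Type*} [Field k] [AddCommGroup L] [Module k L] [AddCommGroup M] [Module k M]
  {ι : Type*} [DecidableEq ι]

theorem DirectSum.IsInternal.linearMap_ext {A : ι → Submodule k L} (hA : DirectSum.IsInternal A)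
    {f g : L →ₗ[k] M} (h : ∀ i, ∀ x ∈ A i, f x = g x) : f = g := by
  have h1 : ∀ x ∈ ⨆ i, A i, f x = g x := fun x hx => by
    have h2 : ⨆ i, A i ≤ LinearMap.eqLocus f g := iSup_le fun i x hx => h i x hx
    exact h2 hx
  exact LinearMap.ext fun x => h1 x (by rw [hA.submodule_iSup_eq_top]; trivial)

/-- A grading which is contained degreewise in another grading is equal to it. -/
theorem DirectSum.IsInternal.eq_of_le {A B : ι → Submodule k L} (hA : DirectSum.IsInternal A)
    (hB : DirectSum.IsInternal B) (h : ∀ i, A i ≤ B i) : A = B := by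
  funext i
  refine eq_of_le_of_inf_le_of_le_sup (z := ⨆ (j) (_ : j ≠ i), A j) (h i) ?_ ?_
  · have := (hB.submodule_iSupIndep i).eq_bot
    refine le_trans (inf_le_inf_left _ (iSup₂_mono fun j _ => h j)) ?_
    rw [this]; exact bot_le
  · have : A i ⊔ ⨆ (j) (_ : j ≠ i), A j = ⊤ := by
      rw [eq_top_iff, ← hA.submodule_iSup_eq_top, iSup_le_iff]
      intro j
      by_cases hj : j = i
      · subst hj; exact le_sup_left
      · exact le_sup_of_le_right (le_iSup₂_of_le j hj le_rfl)
    rw [this]; exact le_top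

theorem DirectSum.IsInternal.prod {A : ι → Submodule k L} (hA : DirectSum.IsInternal A)
    {B : ι → Submodule k M} (hB : DirectSum.IsInternal B) :
    DirectSum.IsInternal fun i => (A i).prod (B i) := by
  rw [DirectSum.isInternal_submodule_iff_iSupIndep_and_iSup_eq_top] at hA hB ⊢
  constructor
  · intro i
    have h : (⨆ (j) (_ : j ≠ i), (A j).prod (B j)) ≤
        (⨆ (j) (_ : j ≠ i), A j).prod (⨆ (j) (_ : j ≠ i), B j) :=
      iSup₂_le fun j hj => Submodule.prod_mono (le_iSup₂_of_le j hj le_rfl)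
        (le_iSup₂_of_le j hj le_rfl)
    refine Disjoint.mono_right h ?_
    rw [disjoint_iff, Submodule.prod_inf_prod, (hA.1 i).eq_bot, (hB.1 i).eq_bot,
      Submodule.prod_bot]
  · rw [eq_top_iff]
    rintro ⟨x, y⟩ -
    have hx : ∀ x ∈ ⨆ i, A i, ((x, 0) : L × M) ∈ ⨆ i, (A i).prod (B i) := fun x hx => by
      have : ⨆ i, A i ≤ (⨆ i, (A i).prod (B i)).comap (LinearMap.inl k L M) :=
        iSup_le fun i x hx => Submodule.mem_iSup_of_mem i ⟨hx, zero_mem _⟩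
      exact this hx
    have hy : ∀ y ∈ ⨆ i, B i, ((0, y) : L × M) ∈ ⨆ i, (A i).prod (B i) := fun x hx => by
      have : ⨆ i, B i ≤ (⨆ i, (A i).prod (B i)).comap (LinearMap.inr k L M) :=
        iSup_le fun i x hx => Submodule.mem_iSup_of_mem i ⟨zero_mem _, hx⟩
      exact this hx
    have := add_mem (hx x (by rw [hA.2]; trivial)) (hy y (by rw [hB.2]; trivial))
    simpa using this

theorem DirectSum.isInternal_ite_top_bot (i₀ : ι) :
    DirectSum.IsInternal fun i => if i = i₀ then (⊤ : Submodule k M) else ⊥ := by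
  rw [DirectSum.isInternal_submodule_iff_iSupIndep_and_iSup_eq_top]
  constructor
  · intro i
    by_cases hi : i = i₀
    · subst hi
      have : (⨆ (j) (_ : j ≠ i), if j = i then (⊤ : Submodule k M) else ⊥) = ⊥ := by
        refine le_bot_iff.1 (iSup₂_le fun j hj => ?_)
        rw [if_neg hj]
      rw [this]; exact disjoint_bot_right
    · simp only [if_neg hi]; exact disjoint_bot_left
  · rw [eq_top_iff]
    exact le_iSup_of_le i₀ (by rw [if_pos rfl])

/-- The linear map which multiplies the homogeneous elements of degree `i` by `(-1)ⁱ`. -/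
noncomputable def DirectSum.IsInternal.sign {A : ℤ → Submodule k L} (hA : DirectSum.IsInternal A) :
    L →ₗ[k] L :=
  DirectSum.toModule k ℤ L (fun i => (i.negOnePow : ℤ) • (A i).subtype) ∘ₗ
    (LinearEquiv.ofBijective (DirectSum.coeLinearMap A) hA).symm.toLinearMap

theorem DirectSum.IsInternal.sign_apply {A : ℤ → Submodule k L} (hA : DirectSum.IsInternal A)
    {i : ℤ} {x : L} (hx : x ∈ A i) : hA.sign x = i.negOnePow • x := by
  have h : (LinearEquiv.ofBijective (DirectSum.coeLinearMap A) hA).symm x =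
      DirectSum.lof k ℤ (fun i => A i) i ⟨x, hx⟩ := by
    rw [LinearEquiv.symm_apply_eq]
    exact (DirectSum.coeLinearMap_lof A i ⟨x, hx⟩).symm
  change DirectSum.toModule k ℤ L _ (LinearEquiv.symm _ x) = _
  rw [h, DirectSum.toModule_lof]
  rfl

end Internal

namespace DGLieAlgebra

variable {k L : Type*} [Field k] [AddCommGroup L] [Module k L] (𝔤 : DGLieAlgebra k L)

/-- The map `x ↦ [x, ∂]`, which is `-(-1)ⁱ d` in degree `i`. -/
noncomputable def rd : L →ₗ[k] L := -(𝔤.d ∘ₗ 𝔤.isInternal.sign)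

theorem rd_apply {i : ℤ} {x : L} (hx : x ∈ 𝔤.gr i) : 𝔤.rd x = -(i.negOnePow • 𝔤.d x) := by
  have h : ∀ (n : ℤˣ) (y : L), 𝔤.d (n • y) = n • 𝔤.d y := fun n y => map_zsmul 𝔤.d (n : ℤ) y
  simp only [rd, LinearMap.neg_apply, LinearMap.comp_apply, 𝔤.isInternal.sign_apply hx, h]

/-- The grading of `L ⊕ k∂`, with `∂` in degree `1`. -/
def extGr (i : ℤ) : Submodule k (L × k) := (𝔤.gr i).prod (if i = 1 then ⊤ else ⊥)

variable {𝔤} in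
theorem mem_extGr {i : ℤ} {a : L × k} : a ∈ 𝔤.extGr i ↔ a.1 ∈ 𝔤.gr i ∧ (i ≠ 1 → a.2 = 0) := by
  rw [extGr, Submodule.mem_prod]
  by_cases hi : i = 1 <;> simp [hi]

theorem extGr_isInternal : DirectSum.IsInternal 𝔤.extGr :=
  𝔤.isInternal.prod (DirectSum.isInternal_ite_top_bot 1)

/-- The bracket of `L ⊕ k∂`: bilinearity and `[∂, ∂] = 0` leave the terms `[x, y]`, `t [∂, y] = t d y`
and `u [x, ∂]` in the bracket of `x + t∂` and `y + u∂`. -/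
noncomputable def extBracket : L × k →ₗ[k] L × k →ₗ[k] L × k :=
  LinearMap.mk₂ k (fun a b => (𝔤.bracket a.1 b.1 + a.2 • 𝔤.d b.1 + b.2 • 𝔤.rd a.1, 0))
    (fun a a' b => by ext <;> simp [add_smul]; abel)
    (fun c a b => by ext <;> simp [mul_smul, smul_comm c])
    (fun a b b' => by ext <;> simp [add_smul]; abel)
    (fun c a b => by ext <;> simp [mul_smul, smul_comm c])

theorem extBracket_apply (a b : L × k) : 𝔤.extBracket a b =
    (𝔤.bracket a.1 b.1 + a.2 • 𝔤.d b.1 + b.2 • 𝔤.rd a.1, 0) := rfl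

theorem rd_d (x : L) : 𝔤.rd (𝔤.d x) = 0 := by
  have : 𝔤.rd ∘ₗ 𝔤.d = 0 := 𝔤.isInternal.linearMap_ext fun i x hx => by
    rw [LinearMap.comp_apply, 𝔤.rd_apply (𝔤.d_mem hx), 𝔤.d_d]; simp
  exact LinearMap.congr_fun this x

theorem extBracket_mem {i j : ℤ} {a b : L × k} (ha : a ∈ 𝔤.extGr i) (hb : b ∈ 𝔤.extGr j) :
    𝔤.extBracket a b ∈ 𝔤.extGr (i + j) := by
  rw [mem_extGr] at *
  refine ⟨add_mem (add_mem (𝔤.bracket_mem ha.1 hb.1) ?_) ?_, fun _ => rfl⟩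
  · by_cases hi : i = 1
    · subst hi; rw [add_comm]; exact Submodule.smul_mem _ _ (𝔤.d_mem hb.1)
    · rw [ha.2 hi, zero_smul]; exact zero_mem _
  · by_cases hj : j = 1
    · subst hj
      rw [𝔤.rd_apply ha.1, Units.smul_def]
      exact Submodule.smul_mem _ _ (neg_mem (zsmul_mem (𝔤.d_mem ha.1) _))
    · rw [hb.2 hj, zero_smul]; exact zero_mem _

theorem extBracket_antisymm {i j : ℤ} {a b : L × k} (ha : a ∈ 𝔤.extGr i) (hb : b ∈ 𝔤.extGr j) :
    𝔤.extBracket a b = -((i * j).negOnePow • 𝔤.extBracket b a) := by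
  rw [mem_extGr] at *
  obtain ⟨x, t⟩ := a
  obtain ⟨y, u⟩ := b
  simp only at ha hb
  simp only [extBracket_apply, 𝔤.rd_apply ha.1, 𝔤.rd_apply hb.1, 𝔤.antisymm ha.1 hb.1]
  have ht : t = 0 ∨ i = 1 := by by_cases hi : i = 1 <;> simp_all
  have hu : u = 0 ∨ j = 1 := by by_cases hj : j = 1 <;> simp_all
  ext
  · rcases ht with rfl | rfl <;> rcases hu with rfl | rfl
    · simp [Units.smul_def]
    · simp [Units.smul_def, smul_comm u]
      abel
    · simp only [one_mul, Units.smul_def, zero_smul, add_zero, Prod.smul_mk, Prod.neg_mk, smul_add,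
        smul_neg, smul_zero]
      rw [smul_comm _ t, smul_smul _ _ (𝔤.d y)]
      simp [← Units.val_mul]
      abel
    · simp
      abel
  · simp [Units.smul_def]

/-- The Jacobi identity, by cases on the parities of `i` and `j`; where the coefficient `t` or `u`
of `∂` does not vanish, the degree is `1`. -/
theorem extBracket_jacobi {i j : ℤ} {a b : L × k} (ha : a ∈ 𝔤.extGr i) (hb : b ∈ 𝔤.extGr j)
    (c : L × k) : 𝔤.extBracket a (𝔤.extBracket b c) =
      𝔤.extBracket (𝔤.extBracket a b) c +
        (i * j).negOnePow • 𝔤.extBracket b (𝔤.extBracket a c) := by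
  rw [mem_extGr] at *
  obtain ⟨x, t⟩ := a
  obtain ⟨y, u⟩ := b
  obtain ⟨z, w⟩ := c
  simp only at ha hb
  have ht : t = 0 ∨ i = 1 := by by_cases hi : i = 1 <;> simp_all
  have hu : u = 0 ∨ j = 1 := by by_cases hj : j = 1 <;> simp_all
  have hx := ha.1
  have hy := hb.1
  clear ha hb
  have h1 := 𝔤.jacobi hx hy z
  have h2 := 𝔤.d_bracket hx z
  have h3 := 𝔤.d_bracket hy z
  have h4 := 𝔤.d_bracket hx y
  have h5 := 𝔤.antisymm (𝔤.d_mem hx) hy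
  have h6 := 𝔤.rd_apply (𝔤.bracket_mem hx hy)
  simp only [extBracket_apply, map_add, map_smul, LinearMap.add_apply, LinearMap.smul_apply,
    zero_smul, add_zero, h6, 𝔤.rd_apply hx, 𝔤.rd_apply hy,
    h1, h2, h3, h4]
  ext
  · rcases Int.even_or_odd i with pi | pi <;> rcases Int.even_or_odd j with pj | pj <;>
    rcases ht with rfl | rfl <;> rcases hu with rfl | rfl <;>
    first
    | exact absurd pi (by decide)
    | exact absurd pj (by decide)
    | (simp [Int.negOnePow_add, Int.negOnePow_even, Int.negOnePow_odd, pi, pj, add_mul, h5,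
        rd_d, 𝔤.d_d]
       try module)
  · simp [Units.smul_def]

theorem one_mem_extGr : ((0, 1) : L × k) ∈ 𝔤.extGr 1 :=
  mem_extGr.2 ⟨zero_mem _, fun h => absurd rfl h⟩

theorem extBracket_partial (a : L × k) : 𝔤.extBracket (0, 1) a = (𝔤.d a.1, 0) := by
  simp [extBracket_apply]

/-- The differential graded Lie algebra `L ⊕ k∂`. -/
noncomputable def ext : DGLieAlgebra k (L × k) where
  gr := 𝔤.extGr
  isInternal := 𝔤.extGr_isInternal
  bracket := 𝔤.extBracket
  bracket_mem := 𝔤.extBracket_mem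
  antisymm := 𝔤.extBracket_antisymm
  jacobi := 𝔤.extBracket_jacobi
  d := 𝔤.extBracket (0, 1)
  d_mem ha := by rw [add_comm]; exact 𝔤.extBracket_mem 𝔤.one_mem_extGr ha
  d_bracket ha b := by
    have := 𝔤.extBracket_jacobi 𝔤.one_mem_extGr ha b
    rwa [one_mul] at this
  d_d a := by simp [extBracket_partial, 𝔤.d_d]

theorem isExtension_ext : 𝔤.IsExtension 𝔤.ext where
  incl_mem hx := mem_extGr.2 ⟨hx, fun _ => rfl⟩
  partial_mem := 𝔤.one_mem_extGr
  bracket_incl x y := by change 𝔤.extBracket _ _ = _; simp [extBracket_apply]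
  bracket_partial_partial := by change 𝔤.extBracket _ _ = _; simp [extBracket_apply]
  bracket_partial_incl x := 𝔤.extBracket_partial _
  d_eq _ := rfl

variable {𝔤} {𝔥 : DGLieAlgebra k (L × k)} (h : 𝔤.IsExtension 𝔥)
include h

theorem IsExtension.gr_eq : 𝔥.gr = 𝔤.extGr := by
  refine (𝔤.extGr_isInternal.eq_of_le 𝔥.isInternal fun i a ha => ?_).symm
  obtain ⟨h1, h2⟩ := mem_extGr.1 ha
  have h3 : a = (a.1, 0) + a.2 • (0, 1) := by ext <;> simp
  rw [h3]
  refine add_mem (h.incl_mem h1) ?_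
  by_cases hi : i = 1
  · subst hi; exact Submodule.smul_mem _ _ h.partial_mem
  · rw [h2 hi, zero_smul]; exact zero_mem _

theorem IsExtension.bracket_incl_partial (x : L) : 𝔥.bracket (x, 0) (0, 1) = (𝔤.rd x, 0) := by
  have : 𝔥.bracket.flip (0, 1) ∘ₗ LinearMap.inl k L k = LinearMap.inl k L k ∘ₗ 𝔤.rd := by
    refine 𝔤.isInternal.linearMap_ext fun i x hx => ?_
    have h1 := 𝔥.antisymm (h.incl_mem hx) h.partial_mem
    rw [h.bracket_partial_incl, mul_one] at h1
    refine h1.trans ?_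
    rw [LinearMap.comp_apply, 𝔤.rd_apply hx]
    ext <;> simp [Units.smul_def]
  exact LinearMap.congr_fun this x

theorem IsExtension.bracket_apply (a b : L × k) : 𝔥.bracket a b =
    (𝔤.bracket a.1 b.1 + a.2 • 𝔤.d b.1 + b.2 • 𝔤.rd a.1, 0) := by
  have h3 : ∀ a : L × k, a = (a.1, 0) + a.2 • (0, 1) := fun a => by ext <;> simp
  rw [h3 a, h3 b]
  simp only [map_add, map_smul, LinearMap.add_apply, LinearMap.smul_apply, h.bracket_incl,
    h.bracket_partial_incl, h.bracket_incl_partial, h.bracket_partial_partial]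
  ext <;> simp

theorem IsExtension.d_apply (a : L × k) : 𝔥.d a = (𝔤.d a.1, 0) := by
  rw [h.d_eq, h.bracket_apply]; simp

/-- The structure on `L ⊕ k∂` is determined by the conditions of `IsExtension`. -/
theorem IsExtension.eq_ext : 𝔥 = 𝔤.ext := by
  have h1 := h.gr_eq
  have h2 : 𝔥.bracket = 𝔤.extBracket := LinearMap.ext₂ fun a b => h.bracket_apply a b
  have h3 : 𝔥.d = 𝔤.extBracket (0, 1) :=
    LinearMap.ext fun a => (h.d_apply a).trans (𝔤.extBracket_partial a).symm
  obtain ⟨⟨gr, _, br, _, _, _⟩, d, _, _, _⟩ := 𝔥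
  simp only at h1 h2 h3
  subst h1 h2 h3
  rfl

end DGLieAlgebra

/-! ### Left-invariant vector fields in the chart at the identity -/

section LeftFrame

variable {E : Type*} [NormedAddCommGroup E] [NormedSpace ℝ E]
  {G : Type*} [TopologicalSpace G] [ChartedSpace E G] [Group G]

/-- The smoothness class which Mathlib requires for the Lie algebra of a real Lie group. -/
theorem LieGroup.of_infty [LieGroup 𝓘(ℝ, E) ∞ G] : LieGroup 𝓘(ℝ, E) (minSmoothness ℝ 3) G :=
  LieGroup.of_le (n := ∞) (by rw [minSmoothness_of_isRCLikeNormedField]; exact ENat.LEInfty.out)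

variable (E) in
/-- The left-invariant vector fields near the identity, read in the chart at the identity: `X` is
sent to the value at `g` of the corresponding field. -/
noncomputable def leftFrame (g : G) : E →L[ℝ] E :=
  mfderiv 𝓘(ℝ, E) 𝓘(ℝ, E) (fun h : G => extChartAt 𝓘(ℝ, E) (1 : G) (g * h)) 1

variable [LieGroup 𝓘(ℝ, E) ∞ G]

theorem contMDiffAt_extChartAt_mul_left {g : G} (hg : g ∈ (extChartAt 𝓘(ℝ, E) (1 : G)).source) :
    ContMDiffAt 𝓘(ℝ, E) 𝓘(ℝ, E) ∞ (fun h : G => extChartAt 𝓘(ℝ, E) (1 : G) (g * h)) 1 := by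
  have : IsManifold 𝓘(ℝ, E) ∞ G := LieGroup.toContMDiffMul.toIsManifold
  refine ContMDiffAt.comp (g := extChartAt 𝓘(ℝ, E) (1 : G)) (f := fun h => g * h) 1 ?_
    contMDiff_mul_left.contMDiffAt
  rw [extChartAt_source] at hg
  refine contMDiffAt_extChartAt' ?_
  rwa [mul_one]

theorem hasMFDerivAt_leftFrame {g : G} (hg : g ∈ (extChartAt 𝓘(ℝ, E) (1 : G)).source) :
    HasMFDerivAt 𝓘(ℝ, E) 𝓘(ℝ, E) (fun h : G => extChartAt 𝓘(ℝ, E) (1 : G) (g * h)) 1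
      (leftFrame E g) :=
  ((contMDiffAt_extChartAt_mul_left hg).mdifferentiableAt (by simp)).hasMFDerivAt

theorem leftFrame_eq_comp {g : G} (hg : g ∈ (extChartAt 𝓘(ℝ, E) (1 : G)).source) :
    leftFrame E g = (mfderiv 𝓘(ℝ, E) 𝓘(ℝ, E) (extChartAt 𝓘(ℝ, E) (1 : G)) g : E →L[ℝ] E).comp
      (mfderiv 𝓘(ℝ, E) 𝓘(ℝ, E) (fun h : G => g * h) 1 : E →L[ℝ] E) := by
  have : IsManifold 𝓘(ℝ, E) ∞ G := LieGroup.toContMDiffMul.toIsManifold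
  have : IsManifold 𝓘(ℝ, E) 1 G := IsManifold.of_le (n := ∞) (by simp)
  have hd : MDifferentiableAt 𝓘(ℝ, E) 𝓘(ℝ, E) (extChartAt 𝓘(ℝ, E) (1 : G)) (g * 1) := by
    rw [extChartAt_source] at hg
    refine mdifferentiableAt_extChartAt ?_
    rwa [mul_one]
  have h1 := mfderiv_comp (1 : G) (g := extChartAt 𝓘(ℝ, E) (1 : G)) (f := fun h : G => g * h) hd
    ((contMDiff_mul_left (n := ∞)).contMDiffAt.mdifferentiableAt (by simp))
  have h2 : ∀ g' : G, g' = g → (mfderiv 𝓘(ℝ, E) 𝓘(ℝ, E) (extChartAt 𝓘(ℝ, E) (1 : G)) g' :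
      E →L[ℝ] E) = mfderiv 𝓘(ℝ, E) 𝓘(ℝ, E) (extChartAt 𝓘(ℝ, E) (1 : G)) g := by
    rintro _ rfl; rfl
  rw [← h2 _ (mul_one g)]
  exact h1

theorem leftFrame_apply {g : G} (hg : g ∈ (extChartAt 𝓘(ℝ, E) (1 : G)).source)
    (X : GroupLieAlgebra 𝓘(ℝ, E) G) : leftFrame E g X =
      mfderiv 𝓘(ℝ, E) 𝓘(ℝ, E) (extChartAt 𝓘(ℝ, E) (1 : G)) g (mulInvariantVectorField X g) := by
  rw [leftFrame_eq_comp hg]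
  rfl

theorem isInvertible_leftFrame {g : G} (hg : g ∈ (extChartAt 𝓘(ℝ, E) (1 : G)).source) :
    (leftFrame E g).IsInvertible := by
  have : IsManifold 𝓘(ℝ, E) ∞ G := LieGroup.toContMDiffMul.toIsManifold
  have : IsManifold 𝓘(ℝ, E) 1 G := IsManifold.of_le (n := ∞) (by simp)
  rw [leftFrame_eq_comp hg]
  refine ContinuousLinearMap.IsInvertible.comp (isInvertible_mfderiv_extChartAt hg) ?_
  have hd : ∀ a b : G, MDifferentiableAt 𝓘(ℝ, E) 𝓘(ℝ, E) (fun h : G => a * h) b := fun a b =>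
    (contMDiff_mul_left (n := ∞)).contMDiffAt.mdifferentiableAt (by simp)
  have key : ∀ (a b : G), (mfderiv 𝓘(ℝ, E) 𝓘(ℝ, E) (fun h : G => a⁻¹ * h) (a * b) : E →L[ℝ] E).comp
      (mfderiv 𝓘(ℝ, E) 𝓘(ℝ, E) (fun h : G => a * h) b : E →L[ℝ] E) =
      ContinuousLinearMap.id ℝ E := by
    intro a b
    have h1 := mfderiv_comp b (hd a⁻¹ (a * b)) (hd a b)
    have h2 : (fun h : G => a⁻¹ * h) ∘ (fun h : G => a * h) = id := by funext h; simp
    rw [h2, mfderiv_id] at h1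
    exact h1.symm
  have k1 := key g 1
  have k2 := key g⁻¹ (g * 1)
  have h2 : ∀ a b : G, a = g → b = 1 →
      (mfderiv 𝓘(ℝ, E) 𝓘(ℝ, E) (fun h : G => a * h) b : E →L[ℝ] E) =
      mfderiv 𝓘(ℝ, E) 𝓘(ℝ, E) (fun h : G => g * h) 1 := by
    rintro _ _ rfl rfl; rfl
  rw [h2 g⁻¹⁻¹ _ (inv_inv g) (by simp)] at k2
  exact ContinuousLinearMap.IsInvertible.of_inverse k2 k1

theorem mpullback_extChartAt_symm {y : E} (hy : y ∈ (extChartAt 𝓘(ℝ, E) (1 : G)).target)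
    (X : GroupLieAlgebra 𝓘(ℝ, E) G) :
    VectorField.mpullback 𝓘(ℝ, E) 𝓘(ℝ, E) (extChartAt 𝓘(ℝ, E) (1 : G)).symm
      (mulInvariantVectorField X) y =
    leftFrame E ((extChartAt 𝓘(ℝ, E) (1 : G)).symm y) X := by
  have : IsManifold 𝓘(ℝ, E) ∞ G := LieGroup.toContMDiffMul.toIsManifold
  have : IsManifold 𝓘(ℝ, E) 1 G := IsManifold.of_le (n := ∞) (by simp)
  rw [leftFrame_apply ((extChartAt 𝓘(ℝ, E) (1 : G)).map_target hy), VectorField.mpullback_apply]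
  have h1 := mfderiv_extChartAt_comp_mfderivWithin_extChartAt_symm (I := 𝓘(ℝ, E)) hy
  have h2 := mfderivWithin_extChartAt_symm_comp_mfderiv_extChartAt (I := 𝓘(ℝ, E)) hy
  rw [modelWithCornersSelf_coe, Set.range_id, mfderivWithin_univ] at h1 h2
  exact congrArg (fun L => L (mulInvariantVectorField X ((extChartAt 𝓘(ℝ, E) (1 : G)).symm y)))
    (ContinuousLinearMap.inverse_eq h2 h1)

/-- The left-invariant frame depends smoothly on the point: it is the partial derivative, in the
second variable, of the multiplication read in the chart. -/
theorem contDiffAt_leftFrame {y : E} (hy : y ∈ (extChartAt 𝓘(ℝ, E) (1 : G)).target) :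
    ContDiffAt ℝ ∞ (fun z => leftFrame E ((extChartAt 𝓘(ℝ, E) (1 : G)).symm z)) y := by
  have : IsManifold 𝓘(ℝ, E) ∞ G := LieGroup.toContMDiffMul.toIsManifold
  set φ := extChartAt 𝓘(ℝ, E) (1 : G) with hφ
  have hψ : ∀ z ∈ φ.target, ContMDiffAt 𝓘(ℝ, E) 𝓘(ℝ, E) ∞ φ.symm z := fun z hz =>
    (contMDiffOn_extChartAt_symm (1 : G)).contMDiffAt ((isOpen_extChartAt_target _).mem_nhds hz)
  have h1 : ContDiffAt ℝ ∞ (Function.uncurry fun a b : E => φ (φ.symm a * φ.symm b))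
      (y, φ 1) := by
    have hm : ContMDiffAt (𝓘(ℝ, E).prod 𝓘(ℝ, E)) 𝓘(ℝ, E) ∞
        (fun p : E × E => φ.symm p.1 * φ.symm p.2) (y, φ 1) :=
      ((hψ y hy).comp (y, φ 1) contMDiffAt_fst).mul
        ((hψ _ (mem_extChartAt_target (1 : G))).comp (y, φ 1) contMDiffAt_snd)
    have hc : ContMDiffAt 𝓘(ℝ, E) 𝓘(ℝ, E) ∞ φ (φ.symm y * φ.symm (φ 1)) := by
      refine contMDiffAt_extChartAt' ?_
      simp only [hφ, extChartAt_to_inv, mul_one]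
      rw [← extChartAt_source 𝓘(ℝ, E)]
      exact φ.map_target hy
    have hcm := ContMDiffAt.comp (y, φ 1) hc hm
    rw [← contMDiffAt_iff_contDiffAt, modelWithCornersSelf_prod, ← chartedSpaceSelf_prod]
    exact hcm
  refine (ContDiffAt.fderiv (m := ∞) h1 (contDiffAt_const (c := φ 1)) (by simp)).congr_of_eventuallyEq ?_
  filter_upwards [(isOpen_extChartAt_target (I := 𝓘(ℝ, E)) (1 : G)).mem_nhds hy] with z hz
  have hd := (contMDiffAt_extChartAt_mul_left (φ.map_target hz)).mdifferentiableAt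
    (n := ∞) (by simp)
  refine Eq.trans (if_pos hd) ?_
  rw [modelWithCornersSelf_coe, Set.range_id, fderivWithin_univ]
  rfl

/-- The frame fields satisfy the bracket relations of the Lie algebra of `G`. -/
theorem lieBracket_leftFrame [CompleteSpace E] {y : E}
    (hy : y ∈ (extChartAt 𝓘(ℝ, E) (1 : G)).target) (X Y : GroupLieAlgebra 𝓘(ℝ, E) G) :
    VectorField.lieBracket ℝ
      (fun z => leftFrame E ((extChartAt 𝓘(ℝ, E) (1 : G)).symm z) X)
      (fun z => leftFrame E ((extChartAt 𝓘(ℝ, E) (1 : G)).symm z) Y) y =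
    leftFrame E ((extChartAt 𝓘(ℝ, E) (1 : G)).symm y) (⁅X, Y⁆ : GroupLieAlgebra 𝓘(ℝ, E) G) := by
  have : LieGroup 𝓘(ℝ, E) (minSmoothness ℝ 3) G := LieGroup.of_infty
  have : IsManifold 𝓘(ℝ, E) ∞ G := LieGroup.toContMDiffMul.toIsManifold
  have : IsManifold 𝓘(ℝ, E) (minSmoothness ℝ 2) G := IsManifold.of_le (n := ∞)
    (by rw [minSmoothness_of_isRCLikeNormedField]; exact ENat.LEInfty.out)
  have hψ : ContMDiffAt 𝓘(ℝ, E) 𝓘(ℝ, E) ∞ (extChartAt 𝓘(ℝ, E) (1 : G)).symm y :=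
    (contMDiffOn_extChartAt_symm (1 : G)).contMDiffAt ((isOpen_extChartAt_target _).mem_nhds hy)
  have h1 := VectorField.mpullback_mlieBracket (n := ∞)
    (mdifferentiableAt_mulInvariantVectorField X (g := (extChartAt 𝓘(ℝ, E) (1 : G)).symm y))
    (mdifferentiableAt_mulInvariantVectorField Y (g := (extChartAt 𝓘(ℝ, E) (1 : G)).symm y))
    hψ (by rw [minSmoothness_of_isRCLikeNormedField]; exact ENat.LEInfty.out)
  rw [← mulInvariantVector_mlieBracket, mpullback_extChartAt_symm hy] at h1
  have hev : ∀ X : GroupLieAlgebra 𝓘(ℝ, E) G,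
      VectorField.mpullback 𝓘(ℝ, E) 𝓘(ℝ, E) (extChartAt 𝓘(ℝ, E) (1 : G)).symm
        (mulInvariantVectorField X) =ᶠ[𝓝 y]
      fun z => leftFrame E ((extChartAt 𝓘(ℝ, E) (1 : G)).symm z) X := fun X => by
    filter_upwards [(isOpen_extChartAt_target (I := 𝓘(ℝ, E)) (1 : G)).mem_nhds hy] with z hz
    exact mpullback_extChartAt_symm hz X
  have hb : ∀ A B : E → E, VectorField.mlieBracket 𝓘(ℝ, E) A B y =
      VectorField.lieBracket ℝ A B y := fun A B => by
    refine (congrFun (VectorField.mlieBracketWithin_univ (V := A) (W := B)).symm y).trans ?_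
    refine (congrFun (VectorField.mlieBracketWithin_eq_lieBracketWithin (V := A) (W := B)) y).trans
      ?_
    exact congrFun VectorField.lieBracketWithin_univ y
  rw [(hev X).mlieBracket_vectorField_eq (hev Y)] at h1
  exact ((hb _ _).symm.trans h1.symm)

end LeftFrame

/-! ### Integration of Lie algebra cocycles -/

section Integration

variable {E : Type*} [NormedAddCommGroup E] [NormedSpace ℝ E]
  {G : Type*} [TopologicalSpace G] [ChartedSpace E G] [Group G]
  {W : Type*} [NormedAddCommGroup W] [NormedSpace ℝ W]

variable {A : G →* (W →L[ℝ] W)} {a : E →L[ℝ] W →L[ℝ] W}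

theorem hasMFDerivAt_monoidHom_mul_left
    (ha : HasMFDerivAt 𝓘(ℝ, E) 𝓘(ℝ, W →L[ℝ] W) A 1 a) (g : G) :
    HasMFDerivAt 𝓘(ℝ, E) 𝓘(ℝ, W →L[ℝ] W) (fun h => A (g * h)) 1
      ((ContinuousLinearMap.compL ℝ W W W (A g)).comp a) := by
  have h1 := (ContinuousLinearMap.compL ℝ W W W (A g)).hasFDerivAt (x := A 1)
  have h2 := h1.hasMFDerivAt.comp (1 : G) ha
  have h3 : (fun h => A (g * h)) = ⇑(ContinuousLinearMap.compL ℝ W W W (A g)) ∘ A := by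
    funext h; exact map_mul A g h
  rw [h3]
  exact h2

variable [LieGroup 𝓘(ℝ, E) ∞ G]

/-- Chain rule for a function given in the chart at the identity, along left-invariant fields. -/
theorem HasFDerivAt.hasMFDerivAt_mul_left {F : Type*} [NormedAddCommGroup F] [NormedSpace ℝ F]
    {f : E → F} {f' : E →L[ℝ] F} {g : G} (hg : g ∈ (extChartAt 𝓘(ℝ, E) (1 : G)).source)
    (hf : HasFDerivAt f f' (extChartAt 𝓘(ℝ, E) (1 : G) g)) :
    HasMFDerivAt 𝓘(ℝ, E) 𝓘(ℝ, F) (fun h : G => f (extChartAt 𝓘(ℝ, E) (1 : G) (g * h))) 1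
      (f'.comp (leftFrame E g)) := by
  have h1 : HasMFDerivAt 𝓘(ℝ, E) 𝓘(ℝ, F) f (extChartAt 𝓘(ℝ, E) (1 : G) (g * 1)) f' := by
    rw [mul_one]; exact hf.hasMFDerivAt
  exact h1.comp (1 : G) (hasMFDerivAt_leftFrame hg)

/-- In the chart, the derivative of `A` along the left-invariant field of `X` is `A · a X`. -/
theorem fderiv_monoidHom_leftFrame (hA : ContMDiff 𝓘(ℝ, E) 𝓘(ℝ, W →L[ℝ] W) ∞ A)
    (ha : HasMFDerivAt 𝓘(ℝ, E) 𝓘(ℝ, W →L[ℝ] W) A 1 a) {y : E}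
    (hy : y ∈ (extChartAt 𝓘(ℝ, E) (1 : G)).target) :
    ContDiffAt ℝ ∞ (fun z => A ((extChartAt 𝓘(ℝ, E) (1 : G)).symm z)) y ∧ ∀ X : E,
      fderiv ℝ (fun z => A ((extChartAt 𝓘(ℝ, E) (1 : G)).symm z)) y
        (leftFrame E ((extChartAt 𝓘(ℝ, E) (1 : G)).symm y) X) =
      (A ((extChartAt 𝓘(ℝ, E) (1 : G)).symm y)).comp (a X) := by
  have : IsManifold 𝓘(ℝ, E) ∞ G := LieGroup.toContMDiffMul.toIsManifold
  set φ := extChartAt 𝓘(ℝ, E) (1 : G) with hφ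
  have h0 : ContDiffAt ℝ ∞ (fun z => A (φ.symm z)) y := by
    rw [← contMDiffAt_iff_contDiffAt]
    exact ContMDiffAt.comp y hA.contMDiffAt
      ((contMDiffOn_extChartAt_symm (1 : G)).contMDiffAt
        ((isOpen_extChartAt_target _).mem_nhds hy))
  refine ⟨h0, fun X => ?_⟩
  have hg : φ.symm y ∈ φ.source := φ.map_target hy
  have h1 : HasFDerivAt (fun z => A (φ.symm z)) (fderiv ℝ (fun z => A (φ.symm z)) y)
      (φ (φ.symm y)) := by
    rw [φ.right_inv hy]
    exact (h0.differentiableAt (by simp)).hasFDerivAt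
  have h2 := h1.hasMFDerivAt_mul_left hg
  have h3 := hasMFDerivAt_monoidHom_mul_left ha (φ.symm y)
  have hev : (fun h => A (φ.symm y * h)) =ᶠ[𝓝 (1 : G)]
      fun h => A (φ.symm (φ (φ.symm y * h))) := by
    have hcont : ContinuousAt (fun h : G => φ.symm y * h) 1 :=
      (contMDiff_mul_left (I := 𝓘(ℝ, E)) (n := ∞)).continuous.continuousAt
    have hs : φ.source ∈ 𝓝 (φ.symm y * 1) := by
      rw [mul_one]; exact (isOpen_extChartAt_source (1 : G)).mem_nhds hg
    filter_upwards [hcont.eventually_mem hs] with h hh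
    rw [φ.left_inv hh]
  have h4 := hasMFDerivAt_unique (h2.congr_of_eventuallyEq hev) h3
  exact congrArg (fun L : E →L[ℝ] (W →L[ℝ] W) => L X) h4

/-- Near the identity, the `W`-valued one-form with value `A g (c X)` on the left-invariant field
of `X` has a smooth primitive: it is closed since `c` is a cocycle, so that the Poincaré lemma
applies in a ball of the chart. -/
theorem exists_primitive_near_one [CompleteSpace E] [CompleteSpace W]
    (hA : ContMDiff 𝓘(ℝ, E) 𝓘(ℝ, W →L[ℝ] W) ∞ A)
    (ha : HasMFDerivAt 𝓘(ℝ, E) 𝓘(ℝ, W →L[ℝ] W) A 1 a) (c : E →L[ℝ] W)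
    (hc : ∀ X Y : GroupLieAlgebra 𝓘(ℝ, E) G,
      c (⁅X, Y⁆ : GroupLieAlgebra 𝓘(ℝ, E) G) = a X (c Y) - a Y (c X)) :
    ∃ U : Set G, IsOpen U ∧ 1 ∈ U ∧ ∃ F : G → W, ContMDiffOn 𝓘(ℝ, E) 𝓘(ℝ, W) ∞ F U ∧
      ∀ g ∈ U, HasMFDerivAt 𝓘(ℝ, E) 𝓘(ℝ, W) (fun h => F (g * h)) 1 ((A g).comp c) := by
  have : IsManifold 𝓘(ℝ, E) ∞ G := LieGroup.toContMDiffMul.toIsManifold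
  set φ := extChartAt 𝓘(ℝ, E) (1 : G) with hφ
  have hopen : IsOpen φ.target := isOpen_extChartAt_target _
  obtain ⟨r, hr, hB⟩ := Metric.mem_nhds_iff.1 (extChartAt_target_mem_nhds (I := 𝓘(ℝ, E)) (1 : G))
  let S : E → E →L[ℝ] E := fun z => leftFrame E (φ.symm z)
  let α : E → W →L[ℝ] W := fun z => A (φ.symm z)
  let η : E → E →L[ℝ] W := fun z => ((α z).comp c).comp (S z).inverse
  have hS : ∀ z ∈ φ.target, ContDiffAt ℝ ∞ S z := fun z hz => contDiffAt_leftFrame hz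
  have hSi : ∀ z ∈ φ.target, (S z).IsInvertible := fun z hz =>
    isInvertible_leftFrame (φ.map_target hz)
  have hα : ∀ z ∈ φ.target, ContDiffAt ℝ ∞ α z := fun z hz =>
    (fderiv_monoidHom_leftFrame hA ha hz).1
  have hη : ∀ z ∈ φ.target, ContDiffAt ℝ ∞ η z := fun z hz =>
    ((hα z hz).clm_comp contDiffAt_const).clm_comp
      ((hSi z hz).contDiffAt_map_inverse.comp z (hS z hz))
  have hηS : ∀ z ∈ φ.target, ∀ X, η z (S z X) = α z (c X) := fun z hz X => by
    change α z (c ((S z).inverse (S z X))) = _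
    rw [(hSi z hz).inverse_apply_self]
  -- evaluating the form on two left-invariant fields shows that it is closed
  have hder : ∀ z ∈ φ.target, ∀ X Y, fderiv ℝ η z (S z Y) (S z X) +
      η z (fderiv ℝ (fun z => S z X) z (S z Y)) = α z (a Y (c X)) := by
    intro z hz X Y
    have h1 : HasFDerivAt (fun z => η z (S z X)) _ z :=
      ((hη z hz).differentiableAt (by simp)).hasFDerivAt.clm_apply
        (((hS z hz).differentiableAt (by simp)).clm_apply
          (differentiableAt_const X)).hasFDerivAt
    have h2 : HasFDerivAt (fun z => α z (c X)) _ z :=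
      ((hα z hz).differentiableAt (by simp)).hasFDerivAt.clm_apply (hasFDerivAt_const (c X) z)
    have h3 := h1.congr_of_eventuallyEq
      (f₁ := fun z => α z (c X)) (by
        filter_upwards [hopen.mem_nhds hz] with z hz
        exact (hηS z hz X).symm)
    have h4 := congrArg (fun L => L (S z Y)) (h3.unique h2)
    have h5 : fderiv ℝ α z (S z Y) = (α z).comp (a Y) :=
      (fderiv_monoidHom_leftFrame hA ha hz).2 Y
    simp only [add_apply, ContinuousLinearMap.comp_apply,
      ContinuousLinearMap.flip_apply, h5, zero_apply, map_zero, zero_add] at h4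
    rw [add_comm]
    exact h4
  have hclosed : ∀ z ∈ φ.target, ∀ v w, fderiv ℝ η z v w = fderiv ℝ η z w v := by
    intro z hz v w
    obtain ⟨X, rfl⟩ := (hSi z hz).surjective v
    obtain ⟨Y, rfl⟩ := (hSi z hz).surjective w
    have h1 := hder z hz X Y
    have h2 := hder z hz Y X
    have h3 := lieBracket_leftFrame (G := G) hz X Y
    have h4 := congrArg (η z) h3
    have h5 := hηS z hz (Bracket.bracket (L := GroupLieAlgebra 𝓘(ℝ, E) G)
      (M := GroupLieAlgebra 𝓘(ℝ, E) G) X Y)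
    have h6 := h4.trans (h5.trans (congrArg (α z) (hc X Y)))
    rw [VectorField.lieBracket, map_sub, map_sub] at h6
    rw [← sub_eq_zero]
    have h7 : fderiv ℝ η z (S z X) (S z Y) = α z (a X (c Y)) -
      η z (fderiv ℝ (fun z => S z Y) z (S z X)) := eq_sub_of_add_eq h2
    have h8 : fderiv ℝ η z (S z Y) (S z X) = α z (a Y (c X)) -
      η z (fderiv ℝ (fun z => S z X) z (S z Y)) := eq_sub_of_add_eq h1
    rw [h7, h8, sub_sub_sub_comm]
    exact sub_eq_zero.2 h6.symm
  obtain ⟨f, hf⟩ := (convex_ball (φ 1) r).exists_forall_hasFDerivAt_of_fderiv_symmetric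
    (𝕜 := ℝ) Metric.isOpen_ball (fun z hz =>
      ((hη z (hB hz)).differentiableAt (by simp)).differentiableWithinAt)
    (fun z hz => hclosed z (hB hz))
  have hfs : ContDiffOn ℝ ∞ f (Metric.ball (φ 1) r) := by
    rw [contDiffOn_infty_iff_fderiv_of_isOpen Metric.isOpen_ball]
    refine ⟨fun z hz => (hf z hz).differentiableAt.differentiableWithinAt, ?_⟩
    have h1 : ContDiffOn ℝ ∞ η (Metric.ball (φ 1) r) := fun z hz =>
      (hη z (hB hz)).contDiffWithinAt
    exact h1.congr fun z hz => (hf z hz).fderiv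
  refine ⟨φ.source ∩ φ ⁻¹' Metric.ball (φ 1) r,
    (continuousOn_extChartAt (1 : G)).isOpen_inter_preimage (isOpen_extChartAt_source _)
      Metric.isOpen_ball, ⟨mem_extChartAt_source _, Metric.mem_ball_self hr⟩,
    fun g => f (φ g), ?_, ?_⟩
  · refine ContMDiffOn.comp (contMDiffOn_iff_contDiffOn.2 hfs) ?_ fun g hg => hg.2
    refine (contMDiffOn_extChartAt (x := (1 : G))).mono fun g hg => ?_
    rw [← extChartAt_source 𝓘(ℝ, E)]; exact hg.1
  · rintro g ⟨hg1, hg2⟩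
    have h1 := (hf _ hg2).hasMFDerivAt_mul_left hg1
    have h2 : (η (φ g)).comp (leftFrame E g) = (A g).comp c := by
      ext X
      have := hηS (φ g) (φ.map_source hg1) X
      simp only [S, α, φ.left_inv hg1] at this
      exact this
    exact h1.congr_mfderiv h2

/-- On a simply connected Lie group a Lie algebra cocycle with values in a smooth representation
is the derivative at the identity of a smooth group cocycle. -/
theorem exists_group_cocycle_of_lie_cocycle [CompleteSpace E] [CompleteSpace W]
    [SimplyConnectedSpace G] (hA : ContMDiff 𝓘(ℝ, E) 𝓘(ℝ, W →L[ℝ] W) ∞ A)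
    (ha : HasMFDerivAt 𝓘(ℝ, E) 𝓘(ℝ, W →L[ℝ] W) A 1 a) (c : E →L[ℝ] W)
    (hc : ∀ X Y : GroupLieAlgebra 𝓘(ℝ, E) G,
      c (⁅X, Y⁆ : GroupLieAlgebra 𝓘(ℝ, E) G) = a X (c Y) - a Y (c X)) :
    ∃ lam : G → W, ContMDiff 𝓘(ℝ, E) 𝓘(ℝ, W) ∞ lam ∧
      (∀ g h, lam (g * h) = lam g + A g (lam h)) ∧
      HasMFDerivAt 𝓘(ℝ, E) 𝓘(ℝ, W) lam 1 c := by
  have : LocallyPathConnectedSpace G := ChartedSpace.locallyPathConnectedSpace E G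
  have : IsManifold 𝓘(ℝ, E) ∞ G := LieGroup.toContMDiffMul.toIsManifold
  have : IsManifold 𝓘(ℝ, E) 1 G := IsManifold.of_le (n := ∞) (by simp)
  obtain ⟨U, hU, h1U, F, hFs, hF⟩ := exists_primitive_near_one hA ha c hc
  have hml : ∀ b : G, ContMDiff 𝓘(ℝ, E) 𝓘(ℝ, E) ∞ fun x : G => b * x := fun b =>
    contMDiff_mul_left
  -- the one-form is equivariant under left translations, so the translates of the primitive,
  -- twisted by `A b`, are primitives near the other points
  let U' : G → Set G := fun b => (fun x => b⁻¹ * x) ⁻¹' U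
  let F' : G → G → W := fun b x => A b (F (b⁻¹ * x))
  have hU' : ∀ b, IsOpen (U' b) := fun b => hU.preimage (hml _).continuous
  have hmem : ∀ b, b ∈ U' b := fun b => by
    change b⁻¹ * b ∈ U
    rwa [inv_mul_cancel]
  have hF's : ∀ b, ContMDiffOn 𝓘(ℝ, E) 𝓘(ℝ, W) ∞ (F' b) (U' b) := fun b =>
    (A b).contMDiff.comp_contMDiffOn
      (hFs.comp (hml b⁻¹).contMDiffOn fun x hx => hx)
  have hF' : ∀ b, ∀ x ∈ U' b,
      HasMFDerivAt 𝓘(ℝ, E) 𝓘(ℝ, W) (fun h => F' b (x * h)) 1 ((A x).comp c) := by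
    intro b x hx
    have h1 := (A b).hasFDerivAt (x := F (b⁻¹ * x * 1)) |>.hasMFDerivAt.comp (1 : G)
      (hF (b⁻¹ * x) hx)
    have h2 : (fun h => F' b (x * h)) = ⇑(A b) ∘ fun h => F (b⁻¹ * x * h) := by
      funext h; simp only [F', Function.comp, mul_assoc]
    have h3 : (A b).comp ((A (b⁻¹ * x)).comp c) = (A x).comp c := by
      have : A x = A b * A (b⁻¹ * x) := by rw [← map_mul, mul_inv_cancel_left]
      rw [this]; rfl
    rw [h2]
    exact h1.congr_mfderiv h3
  obtain ⟨f, hf⟩ := exists_eventually_sub_eq_of_simplyConnectedSpace U' hU' hmem F' (by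
    rintro b b' x ⟨hx, hx'⟩
    refine eventually_eq_of_eventually_hasMFDerivAt_zero (E := E)
      (f := fun y => F' b y - F' b' y) ?_
    filter_upwards [(hU' b).mem_nhds hx, (hU' b').mem_nhds hx'] with y hy hy'
    refine hasMFDerivAt_zero_of_mul_left ?_
    have h1 := (hF' b y hy).sub (hF' b' y hy')
    exact h1.congr_mfderiv (sub_self ((A y).comp c)))
  have hloc : ∀ b, f =ᶠ[𝓝 b] fun y => F' b y + (f b - F' b b) := fun b => by
    filter_upwards [hf b b (hmem b)] with y hy
    rw [← hy]; abel
  have hfs : ContMDiff 𝓘(ℝ, E) 𝓘(ℝ, W) ∞ f := fun b =>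
    (((hF's b).contMDiffAt ((hU' b).mem_nhds (hmem b))).add
      contMDiffAt_const).congr_of_eventuallyEq (hloc b)
  have hfd : ∀ x, HasMFDerivAt 𝓘(ℝ, E) 𝓘(ℝ, W) (fun h => f (x * h)) 1 ((A x).comp c) := by
    intro x
    have h1 := (hF' x x (hmem x)).add (hasMFDerivAt_const (I := 𝓘(ℝ, E)) (I' := 𝓘(ℝ, W))
      (f x - F' x x) (1 : G))
    have h2 := h1.congr_mfderiv (add_zero ((A x).comp c))
    refine h2.congr_of_eventuallyEq ?_
    have hcont : Tendsto (fun h : G => x * h) (𝓝 1) (𝓝 x) := by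
      have := (hml x).continuous.continuousAt (x := (1 : G))
      rwa [ContinuousAt, mul_one] at this
    exact hcont.eventually (hloc x)
  refine ⟨fun g => f g - f 1, hfs.sub contMDiff_const, fun g h => ?_, ?_⟩
  · -- the defect of the cocycle identity has zero derivative in `h`
    change f (g * h) - f 1 = f g - f 1 + A g (f h - f 1)
    have key := eq_one_of_hasMFDerivAt_mul_left_zero (E := E)
      (f := fun h => f (g * h) - A g (f h)) (fun x => ?_) h
    · simp only [mul_one] at key
      rw [map_sub, ← sub_eq_zero]
      rw [← sub_eq_zero] at key
      rw [← key]; abel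
    · have h1 := hfd (g * x)
      have h2 := (A g).hasFDerivAt (x := f (x * 1)) |>.hasMFDerivAt.comp (1 : G) (hfd x)
      have h3 : (fun h => f (g * (x * h)) - A g (f (x * h))) =
          (fun h => f (g * x * h)) - (⇑(A g) ∘ fun h => f (x * h)) := by
        funext h; simp only [Pi.sub_apply, Function.comp, mul_assoc]
      have h4 : (A (g * x)).comp c - (A g).comp ((A x).comp c) = 0 := by
        rw [map_mul]; exact sub_self _
      rw [h3]
      exact (h1.sub h2).congr_mfderiv h4
  · have h1 := (hfd 1).sub (hasMFDerivAt_const (I := 𝓘(ℝ, E)) (I' := 𝓘(ℝ, W)) (f 1) (1 : G))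
    have h2 : (A 1).comp c - 0 = c := by rw [map_one, sub_zero]; rfl
    have h3 := h1.congr_mfderiv h2
    exact h3.congr_of_eventuallyEq (Eventually.of_forall fun h => by simp)

end Integration

/-! ### Cocycles and extended actions -/

section ExtendedAction

variable {E : Type*} [NormedAddCommGroup E] [NormedSpace ℝ E]
  {G : Type*} [Group G]
  {V : Type*} [AddCommGroup V] [Module ℝ V]

theorem map_one_eq_zero_of_cocycle {α : Representation ℝ G V} {lam : G → V}
    (h : ∀ g h : G, lam (g * h) = lam g + α g (lam h)) : lam 1 = 0 := by
  simpa using h 1 1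

theorem Representation.apply_inv_apply (α : Representation ℝ G V) (g : G) (x : V) :
    α g (α g⁻¹ x) = x := by
  rw [← Module.End.mul_apply, ← map_mul, mul_inv_cancel, map_one, Module.End.one_apply]

theorem Representation.inv_apply_apply (α : Representation ℝ G V) (g : G) (x : V) :
    α g⁻¹ (α g x) = x := by
  rw [← Module.End.mul_apply, ← map_mul, inv_mul_cancel, map_one, Module.End.one_apply]

/-- The representation of `G` on `V ⊕ ℝ∂` with `g ∂ = ∂ + lam g` given by a cocycle `lam`. -/
noncomputable def Representation.extendByCocycle (α : Representation ℝ G V) (lam : G → V)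
    (h : ∀ g h : G, lam (g * h) = lam g + α g (lam h)) : Representation ℝ G (V × ℝ) where
  toFun g := LinearMap.prod
    (α g ∘ₗ LinearMap.fst ℝ V ℝ + LinearMap.toSpanSingleton ℝ V (lam g) ∘ₗ LinearMap.snd ℝ V ℝ)
    (LinearMap.snd ℝ V ℝ)
  map_one' := by
    refine LinearMap.ext fun a => ?_
    simp [map_one_eq_zero_of_cocycle h]
  map_mul' g g' := by
    refine LinearMap.ext fun a => ?_
    simp [h]
    abel

theorem Representation.extendByCocycle_apply (α : Representation ℝ G V) (lam : G → V)
    (h : ∀ g h : G, lam (g * h) = lam g + α g (lam h)) (g : G) (a : V × ℝ) :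
    α.extendByCocycle lam h g a = (α g a.1 + a.2 • lam g, a.2) := rfl

/-- A representation on `V ⊕ ℝ∂` extending `α` is determined by its values on `∂`. -/
theorem Representation.eq_extend_apply {α : Representation ℝ G V} {β : Representation ℝ G (V × ℝ)}
    (h : ∀ (g : G) (x : V), β g (x, 0) = (α g x, 0)) (g : G) (a : V × ℝ) :
    β g a = (α g a.1 + a.2 • (β g (0, 1)).1, a.2 • (β g (0, 1)).2) := by
  have h3 : a = (a.1, 0) + a.2 • (0, 1) := by ext <;> simp
  conv_lhs => rw [h3, map_add, map_smul, h]
  ext <;> simp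

/-- The action on the quotient `(V ⊕ ℝ∂) / V` is multiplicative. -/
theorem Representation.snd_mul_of_restrict {α : Representation ℝ G V}
    {β : Representation ℝ G (V × ℝ)}
    (hβ : ∀ (g : G) (x : V), β g (x, 0) = (α g x, 0)) (g h : G) :
    (β (g * h) (0, 1)).2 = (β h (0, 1)).2 * (β g (0, 1)).2 := by
  rw [map_mul, Module.End.mul_apply, Representation.eq_extend_apply hβ g]
  simp

variable [TopologicalSpace G] [ChartedSpace E G]
  {𝔤 : DGLieAlgebra ℝ V} {𝔥 : DGLieAlgebra ℝ (V × ℝ)}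
  {ι : GroupLieAlgebra 𝓘(ℝ, E) G →ₗ[ℝ] V} {α : Representation ℝ G V}

theorem IsHarishChandraPair.hasDerivAtOne {𝔤 : GLieAlgebra ℝ V}
    (hP : IsHarishChandraPair 𝔤 ι α) (X : GroupLieAlgebra 𝓘(ℝ, E) G) (x : V) :
    HasDerivAtOne (fun g => α g x) X (𝔤.bracket (ι X) x) :=
  ⟨hP.smooth x, hP.differential X x⟩

theorem IsHarishChandraPair.ι_mem {𝔤 : GLieAlgebra ℝ V}
    (hP : IsHarishChandraPair 𝔤 ι α) (X : GroupLieAlgebra 𝓘(ℝ, E) G) : ι X ∈ 𝔤.gr 0 := by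
  rw [← hP.ι_range]; exact ⟨X, rfl⟩

theorem IsDGCocycle.isExtendedAction (hE : 𝔤.IsExtension 𝔥)
    (hP : IsHarishChandraPair 𝔤.toGLieAlgebra ι α) {lam : G → V} (hl : IsDGCocycle E 𝔤 α lam) :
    IsExtendedAction E 𝔥.toGLieAlgebra α (α.extendByCocycle lam hl.cocycle) where
  restrict g x := by simp [Representation.extendByCocycle_apply]
  map_mem g i a ha := by
    rw [hE.gr_eq, DGLieAlgebra.mem_extGr] at *
    rw [Representation.extendByCocycle_apply]
    refine ⟨add_mem (hP.map_mem g ha.1) ?_, ha.2⟩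
    by_cases hi : i = 1
    · subst hi; exact Submodule.smul_mem _ _ (hl.mem g)
    · rw [ha.2 hi, zero_smul]; exact zero_mem _
  smooth a φ := by
    have h1 := (hP.smooth a.1 (φ ∘ₗ LinearMap.inl ℝ V ℝ)).add
      ((hl.smooth (a.2 • φ ∘ₗ LinearMap.inl ℝ V ℝ)).add
        (contMDiff_const (c := φ (0, a.2))))
    convert h1 using 1
    funext g
    have h2 : α.extendByCocycle lam hl.cocycle g a =
        (α g a.1, 0) + (a.2 • (lam g, 0) + (0, a.2)) := by
      ext <;> simp [Representation.extendByCocycle_apply]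
    simp only [h2, map_add, map_smul]
    rfl
  equivariant g a x := by
    simp only [hE.bracket_apply, Representation.extendByCocycle_apply, zero_smul, add_zero,
      map_add, map_smul, LinearMap.add_apply, LinearMap.smul_apply, hl.bracket_eq,
      hP.map_bracket, α.apply_inv_apply]
    ext
    · simp only [smul_sub]; abel
    · rfl

theorem IsExtendedAction.isDGCocycle (hE : 𝔤.IsExtension 𝔥) {β : Representation ℝ G (V × ℝ)}
    (hβ : IsExtendedAction E 𝔥.toGLieAlgebra α β) (h1 : ∀ g : G, (β g (0, 1)).2 = 1) :
    IsDGCocycle E 𝔤 α fun g => (β g (0, 1)).1 where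
  mem g := by
    have := hβ.map_mem g hE.partial_mem
    rw [hE.gr_eq, DGLieAlgebra.mem_extGr] at this
    exact this.1
  smooth φ := hβ.smooth (0, 1) (φ ∘ₗ LinearMap.fst ℝ V ℝ)
  cocycle g h := by
    rw [map_mul, Module.End.mul_apply, Representation.eq_extend_apply hβ.restrict g, h1]
    simp [add_comm]
  bracket_eq g x := by
    have := congrArg Prod.fst (hβ.equivariant g (0, 1) x)
    simp only [hE.bracket_apply, h1, hβ.restrict, one_smul, zero_smul, add_zero, map_zero,
      LinearMap.zero_apply, zero_add] at this
    rw [← this]; abel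

/-- Cocycles correspond to the extended actions which are trivial on the quotient `ℝ∂`. -/
noncomputable def cocycleEquivExtendedAction (hE : 𝔤.IsExtension 𝔥)
    (hP : IsHarishChandraPair 𝔤.toGLieAlgebra ι α) :
    {lam : G → V // IsDGCocycle E 𝔤 α lam} ≃ {β : Representation ℝ G (V × ℝ) //
      IsExtendedAction E 𝔥.toGLieAlgebra α β ∧ ∀ g : G, (β g (0, 1)).2 = 1} where
  toFun lam := ⟨α.extendByCocycle lam.1 lam.2.cocycle, lam.2.isExtendedAction hE hP,
    fun _ => rfl⟩
  invFun β := ⟨fun g => (β.1 g (0, 1)).1, β.2.1.isDGCocycle hE β.2.2⟩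
  left_inv lam := by
    ext g
    simp [Representation.extendByCocycle_apply]
  right_inv β := by
    refine Subtype.ext (MonoidHom.ext fun g => LinearMap.ext fun a => ?_)
    refine (α.extendByCocycle_apply _ (β.2.1.isDGCocycle hE β.2.2).cocycle g a).trans ?_
    rw [Representation.eq_extend_apply β.2.1.restrict g a, β.2.2]
    simp

section MaurerCartan

variable {lam : G → V} (hl : IsDGCocycle E 𝔤 α lam)
include hl

/-- The condition on `ad (lam g)`, read from the right: `[g x, ∂ + lam g] = g [x, ∂]`. -/
theorem IsDGCocycle.bracket_right (hP : IsHarishChandraPair 𝔤.toGLieAlgebra ι α) (g : G) (x : V) :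
    𝔤.bracket (α g x) (lam g) + 𝔤.rd (α g x) = α g (𝔤.rd x) := by
  have h : 𝔤.bracket.flip (lam g) ∘ₗ α g + 𝔤.rd ∘ₗ α g = α g ∘ₗ 𝔤.rd := by
    refine 𝔤.isInternal.linearMap_ext fun i x hx => ?_
    have hx' := hP.map_mem g hx
    simp only [LinearMap.add_apply, LinearMap.comp_apply, LinearMap.flip_apply,
      𝔤.antisymm hx' (hl.mem g), hl.bracket_eq, α.inv_apply_apply, 𝔤.rd_apply hx',
      𝔤.rd_apply hx, mul_one, Units.smul_def, map_neg, map_zsmul]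
    simp [smul_sub]
    abel
  exact LinearMap.congr_fun h x

theorem IsDGCocycle.rd_eq (g : G) : 𝔤.rd (lam g) = 𝔤.d (lam g) := by
  rw [𝔤.rd_apply (hl.mem g)]; simp

/-- The failure of `∂ ↦ ∂ + lam g` to respect brackets is concentrated in `[∂, ∂]`, where it is
twice the Maurer-Cartan curvature of `lam g`, because
`[∂ + lam g, ∂ + lam g] = 2 d (lam g) + [lam g, lam g]`. -/
theorem IsDGCocycle.bracket_extendByCocycle (hE : 𝔤.IsExtension 𝔥)
    (hP : IsHarishChandraPair 𝔤.toGLieAlgebra ι α) (g : G) (a b : V × ℝ) :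
    𝔥.bracket (α.extendByCocycle lam hl.cocycle g a) (α.extendByCocycle lam hl.cocycle g b) =
      α.extendByCocycle lam hl.cocycle g (𝔥.bracket a b) +
      ((2 * a.2 * b.2) • (𝔤.d (lam g) + (1 / 2 : ℝ) • 𝔤.bracket (lam g) (lam g)), 0) := by
  have h1 := hl.bracket_right hP g a.1
  have h2 := hl.bracket_eq g (α g b.1)
  rw [α.inv_apply_apply] at h2
  have h3 := eq_sub_of_add_eq h1
  simp only [hE.bracket_apply, Representation.extendByCocycle_apply, map_add, map_smul,
    LinearMap.add_apply, LinearMap.smul_apply, hP.map_bracket, hl.rd_eq, h2, h3]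
  ext
  · simp only [Prod.fst_add]
    module
  · simp

theorem IsDGCocycle.map_bracket_iff (hE : 𝔤.IsExtension 𝔥)
    (hP : IsHarishChandraPair 𝔤.toGLieAlgebra ι α) :
    (∀ (g : G) (a b : V × ℝ), α.extendByCocycle lam hl.cocycle g (𝔥.bracket a b) =
      𝔥.bracket (α.extendByCocycle lam hl.cocycle g a)
        (α.extendByCocycle lam hl.cocycle g b)) ↔
      ∀ g : G, 𝔤.d (lam g) + (1 / 2 : ℝ) • 𝔤.bracket (lam g) (lam g) = 0 := by
  refine forall_congr' fun g => ⟨fun h => ?_, fun h a b => ?_⟩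
  · have h1 := h (0, 1) (0, 1)
    rw [hl.bracket_extendByCocycle hE hP, left_eq_add] at h1
    exact (smul_eq_zero.1 (congrArg Prod.fst h1)).resolve_left (by norm_num)
  · rw [hl.bracket_extendByCocycle hE hP, h]
    simp

theorem IsDGCocycle.isHarishChandraPair_iff (hE : 𝔤.IsExtension 𝔥)
    (hP : IsHarishChandraPair 𝔤.toGLieAlgebra ι α) :
    IsHarishChandraPair 𝔥.toGLieAlgebra (LinearMap.inl ℝ V ℝ ∘ₗ ι)
        (α.extendByCocycle lam hl.cocycle) ↔
      (∀ g : G, 𝔤.d (lam g) + (1 / 2 : ℝ) • 𝔤.bracket (lam g) (lam g) = 0) ∧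
        ∀ X : GroupLieAlgebra 𝓘(ℝ, E) G, DerivAtOneEq lam X (-𝔤.d (ι X)) := by
  have hrd : ∀ X, 𝔤.rd (ι X) = -𝔤.d (ι X) := fun X => by
    rw [𝔤.rd_apply (hP.ι_mem X)]; simp
  have hβ := hl.isExtendedAction hE hP
  constructor
  · intro h
    refine ⟨(hl.map_bracket_iff hE hP).1 h.map_bracket, fun X => ?_⟩
    have h1 := (h.hasDerivAtOne X (0, 1)).map (LinearMap.fst ℝ V ℝ)
    simp only [LinearMap.comp_apply, LinearMap.inl_apply, hE.bracket_incl_partial, hrd,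
      LinearMap.fst_apply, Representation.extendByCocycle_apply, map_zero, zero_add,
      one_smul] at h1
    exact h1.2
  · rintro ⟨h1, h2⟩
    refine ⟨fun i hi => ?_, fun i => ?_, ?_, ?_, fun X Y => ?_, hβ.map_mem,
      (hl.map_bracket_iff hE hP).2 h1, hβ.smooth, fun g X => ?_, fun X a => ?_⟩
    · rw [hE.gr_eq, DGLieAlgebra.extGr, hP.nonneg i hi, if_neg (by omega), Submodule.prod_bot]
    · have := hP.finiteDimensional i
      rw [hE.gr_eq]
      exact Module.Finite.iff_fg.2 ((Module.Finite.iff_fg.1 this).prod (Submodule.FG.of_finite))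
    · exact LinearMap.inl_injective.comp hP.ι_injective
    · rw [LinearMap.range_comp, hP.ι_range, hE.gr_eq]
      ext a
      rw [DGLieAlgebra.mem_extGr]
      constructor
      · rintro ⟨x, hx, rfl⟩
        exact ⟨hx, fun _ => rfl⟩
      · rintro ⟨h3, h4⟩
        exact ⟨a.1, h3, Prod.ext rfl (h4 (by decide)).symm⟩
    · simp [hP.ι_bracket, hE.bracket_incl]
    · simp [hβ.restrict, hP.adjoint]
    · have h3 := ((hP.hasDerivAtOne X a.1).add
        (HasDerivAtOne.map (a.2 • LinearMap.id) ⟨hl.smooth, h2 X⟩)).map (LinearMap.inl ℝ V ℝ)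
      have h4 := (h3.add (HasDerivAtOne.const ((0, a.2) : V × ℝ))).2
      convert h4 using 1
      · funext g
        ext <;> simp [Representation.extendByCocycle_apply]
      · rw [hE.bracket_apply]
        ext <;> simp [hrd]

end MaurerCartan

end ExtendedAction

/-! ### Extensions for connected and simply connected groups -/

section Connected

variable {E : Type*} [NormedAddCommGroup E] [NormedSpace ℝ E]
  {G : Type*} [TopologicalSpace G] [ChartedSpace E G] [Group G]
  {V : Type*} [AddCommGroup V] [Module ℝ V]
  {𝔤 : DGLieAlgebra ℝ V} {𝔥 : DGLieAlgebra ℝ (V × ℝ)}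
  {ι : GroupLieAlgebra 𝓘(ℝ, E) G →ₗ[ℝ] V} {α : Representation ℝ G V}

theorem DGLieAlgebra.d_bracket_of_mem_zero {x y : V} (hx : x ∈ 𝔤.gr 0) :
    𝔤.d (𝔤.bracket x y) = 𝔤.bracket (𝔤.d x) y + 𝔤.bracket x (𝔤.d y) := by
  simpa using 𝔤.d_bracket hx y

/-- A connected group acts trivially on `(V ⊕ ℝ∂) / V` if the derivative of the corresponding
character vanishes. -/
theorem Representation.snd_eq_one_of_hasDerivAtOne_zero [LieGroup 𝓘(ℝ, E) ∞ G]
    [ConnectedSpace G] {β : Representation ℝ G (V × ℝ)}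
    (hβ : ∀ (g : G) (x : V), β g (x, 0) = (α g x, 0))
    (h : ∀ X, HasDerivAtOne (E := E) (fun g => (β g (0, 1)).2) X 0) (g : G) :
    (β g (0, 1)).2 = 1 := by
  have key := eq_one_of_hasDerivAtOne_mul_left_zero (E := E) (f := fun g => (β g (0, 1)).2)
    (fun g X => ?_) g
  · simpa using key
  · have h1 := (h X).map ((β g (0, 1)).2 • LinearMap.id)
    simp only [Representation.snd_mul_of_restrict hβ]
    simpa [mul_comm] using h1

/-- The character through which an extended action acts on the quotient `ℝ∂` has zero derivative:
differentiating `[g ∂, g x] = g [∂, x]` expresses the multiple of the differential by the derivative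
as an inner derivation. -/
theorem IsExtendedAction.hasDerivAtOne_snd (hO : 𝔤.IsOuter) (hE : 𝔤.IsExtension 𝔥)
    (hP : IsHarishChandraPair 𝔤.toGLieAlgebra ι α) {β : Representation ℝ G (V × ℝ)}
    (hβ : IsExtendedAction E 𝔥.toGLieAlgebra α β) (X : GroupLieAlgebra 𝓘(ℝ, E) G) :
    HasDerivAtOne (fun g => (β g (0, 1)).2) X 0 := by
  have hfin := hP.finiteDimensional 1
  obtain ⟨χ', hχ⟩ := (hβ.smooth (0, 1)).exists_hasDerivAtOne_dual (LinearMap.snd ℝ V ℝ) X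
  have hmem : ∀ g, (β g (0, 1)).1 ∈ 𝔤.gr 1 := fun g => by
    have := hβ.map_mem g hE.partial_mem
    rw [hE.gr_eq, DGLieAlgebra.mem_extGr] at this
    exact this.1
  have hs : SmoothMap E fun g => (β g (0, 1)).1 := fun φ =>
    hβ.smooth (0, 1) (φ ∘ₗ LinearMap.fst ℝ V ℝ)
  obtain ⟨v, hv, hlam⟩ := hs.exists_hasDerivAtOne hmem X
  have key : ∀ x, χ' • 𝔤.d x = -𝔤.bracket (v + 𝔤.d (ι X)) x := by
    intro x
    have h1 := HasDerivAtOne.apply (A := fun g => 𝔤.bracket.flip (α g x))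
      (A' := 𝔤.bracket.flip (𝔤.bracket (ι X) x))
      (fun y _ => (hP.hasDerivAtOne X x).map (𝔤.bracket y)) hlam hmem
    have h2 := hχ.smul ((hP.hasDerivAtOne X x).map 𝔤.d)
    have h3 := hP.hasDerivAtOne X (𝔤.d x)
    have h4 : ∀ g, 𝔤.bracket.flip (α g x) (β g (0, 1)).1 +
        LinearMap.snd ℝ V ℝ (β g (0, 1)) • 𝔤.d (α g x) = α g (𝔤.d x) := by
      intro g
      have := congrArg Prod.fst (hβ.equivariant g (0, 1) (α g x))
      rw [α.inv_apply_apply] at this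
      simpa [hE.bracket_apply, hβ.restrict] using this
    have h5 := h1.add h2
    simp only [h4] at h5
    have h6 := h5.unique h3
    simp only [LinearMap.flip_apply, LinearMap.snd_apply, map_one, Module.End.one_apply,
      one_smul, 𝔤.d_bracket_of_mem_zero (hP.ι_mem X), map_zero,
      add_zero] at h6
    rw [map_add, LinearMap.add_apply, ← sub_eq_zero]
    rw [← sub_eq_zero] at h6
    rw [← h6]
    abel
  have h0 : χ' = 0 := by
    by_contra hne
    refine hO ⟨-(χ'⁻¹ • (v + 𝔤.d (ι X))), neg_mem (Submodule.smul_mem _ _ (add_mem hv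
      (𝔤.d_mem (hP.ι_mem X)))), fun x => ?_⟩
    rw [map_neg, map_smul, LinearMap.neg_apply, LinearMap.smul_apply, ← smul_neg, ← key,
      inv_smul_smul₀ hne]
  rw [h0] at hχ
  exact hχ

end Connected

section SimplyConnected

variable {E : Type*} [NormedAddCommGroup E] [NormedSpace ℝ E]
  {G : Type*} [TopologicalSpace G] [ChartedSpace E G] [Group G]
  {V : Type*} [AddCommGroup V] [Module ℝ V]
  {𝔤 : DGLieAlgebra ℝ V} {𝔥 : DGLieAlgebra ℝ (V × ℝ)}
  {ι : GroupLieAlgebra 𝓘(ℝ, E) G →ₗ[ℝ] V} {α : Representation ℝ G V}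

/-- In a Harish-Chandra pair extending `(G, 𝔤, α)`, the group acts trivially on `ℝ∂`. -/
theorem IsHarishChandraPair.snd_eq_one [LieGroup 𝓘(ℝ, E) ∞ G] [ConnectedSpace G]
    (hE : 𝔤.IsExtension 𝔥) {β : Representation ℝ G (V × ℝ)}
    (hr : ∀ (g : G) (x : V), β g (x, 0) = (α g x, 0))
    (hβ : IsHarishChandraPair 𝔥.toGLieAlgebra (LinearMap.inl ℝ V ℝ ∘ₗ ι) β) (g : G) :
    (β g (0, 1)).2 = 1 := by
  refine Representation.snd_eq_one_of_hasDerivAtOne_zero (E := E) hr (fun X => ?_) g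
  have h1 := (hβ.hasDerivAtOne X (0, 1)).map (LinearMap.snd ℝ V ℝ)
  simpa [hE.bracket_apply] using h1

/-- For connected `G`, an extension of the pair to `𝔤 ⊕ ℝ∂` is unique: the difference of the two
cocycles is a cocycle, and its derivative vanishes because both derivatives are given by `ad`. -/
theorem IsHarishChandraPair.eq_of_restrict [LieGroup 𝓘(ℝ, E) ∞ G] [ConnectedSpace G]
    (hE : 𝔤.IsExtension 𝔥) {β₁ β₂ : Representation ℝ G (V × ℝ)}
    (hr₁ : ∀ (g : G) (x : V), β₁ g (x, 0) = (α g x, 0))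
    (h₁ : IsHarishChandraPair 𝔥.toGLieAlgebra (LinearMap.inl ℝ V ℝ ∘ₗ ι) β₁)
    (hr₂ : ∀ (g : G) (x : V), β₂ g (x, 0) = (α g x, 0))
    (h₂ : IsHarishChandraPair 𝔥.toGLieAlgebra (LinearMap.inl ℝ V ℝ ∘ₗ ι) β₂) : β₁ = β₂ := by
  have hs₁ := h₁.snd_eq_one hE hr₁
  have hs₂ := h₂.snd_eq_one hE hr₂
  have key : ∀ g, (β₁ g (0, 1)).1 - (β₂ g (0, 1)).1 = 0 := by
    intro g
    have := eq_one_of_hasDerivAtOne_mul_left_zero (E := E)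
      (f := fun g => (β₁ g (0, 1)).1 - (β₂ g (0, 1)).1) (fun g X => ?_) g
    · simpa using this
    · have h3 := (((h₁.hasDerivAtOne X (0, 1)).sub (h₂.hasDerivAtOne X (0, 1))).map
        (α g ∘ₗ LinearMap.fst ℝ V ℝ)).add
          (HasDerivAtOne.const ((β₁ g (0, 1)).1 - (β₂ g (0, 1)).1))
      have h4 : ∀ h, (β₁ (g * h) (0, 1)).1 - (β₂ (g * h) (0, 1)).1 =
          (α g ∘ₗ LinearMap.fst ℝ V ℝ) (β₁ h (0, 1) - β₂ h (0, 1)) +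
          ((β₁ g (0, 1)).1 - (β₂ g (0, 1)).1) := fun h => by
        rw [map_mul, map_mul, Module.End.mul_apply, Module.End.mul_apply,
          Representation.eq_extend_apply hr₁ g, Representation.eq_extend_apply hr₂ g, hs₁, hs₂]
        simp
        abel
      simp only [h4]
      simpa using h3
  refine MonoidHom.ext fun g => LinearMap.ext fun a => ?_
  rw [Representation.eq_extend_apply hr₁ g, Representation.eq_extend_apply hr₂ g, hs₁, hs₂,
    sub_eq_zero.1 (key g)]

theorem HasDerivAtOne.hasMFDerivAt {F : Type*} [NormedAddCommGroup F] [NormedSpace ℝ F]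
    [FiniteDimensional ℝ F] {f : G → F} {L : E →L[ℝ] F}
    (h : ∀ X : GroupLieAlgebra 𝓘(ℝ, E) G, HasDerivAtOne f X (L X)) :
    ContMDiff 𝓘(ℝ, E) 𝓘(ℝ, F) ∞ f ∧ HasMFDerivAt 𝓘(ℝ, E) 𝓘(ℝ, F) f 1 L := by
  have h1 := (smoothMap_iff_contMDiff f).1 (h 0).1
  have h2 := (h1.contMDiffAt (x := (1 : G)).mdifferentiableAt (by simp)).hasMFDerivAt
  refine ⟨h1, h2.congr_mfderiv (ContinuousLinearMap.ext fun X => ?_)⟩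
  have h3 : ∀ φ : Module.Dual ℝ F, φ (mfderiv 𝓘(ℝ, E) 𝓘(ℝ, F) f 1 X : F) = φ (L X) := fun φ => by
    rw [← (h X).2 φ]
    have h4 := (LinearMap.toContinuousLinearMap φ).hasFDerivAt (x := f 1) |>.hasMFDerivAt.comp
      (1 : G) h2
    exact (congrArg (fun L : E →L[ℝ] ℝ => L X) h4.mfderiv).symm
  refine sub_eq_zero.1 ((Module.forall_dual_apply_eq_zero_iff ℝ _).1 fun φ => ?_)
  exact (map_sub φ _ _).trans (sub_eq_zero.2 (h3 φ))

theorem HasMFDerivAt.hasDerivAtOne {F : Type*} [NormedAddCommGroup F] [NormedSpace ℝ F]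
    [FiniteDimensional ℝ F] {f : G → F} {L : E →L[ℝ] F} (hf : ContMDiff 𝓘(ℝ, E) 𝓘(ℝ, F) ∞ f)
    (h : HasMFDerivAt 𝓘(ℝ, E) 𝓘(ℝ, F) f 1 L) (X : GroupLieAlgebra 𝓘(ℝ, E) G) :
    HasDerivAtOne f X (L X) := by
  refine ⟨(smoothMap_iff_contMDiff f).2 hf, fun φ => ?_⟩
  have h4 := (LinearMap.toContinuousLinearMap φ).hasFDerivAt (x := f 1) |>.hasMFDerivAt.comp
      (1 : G) h
  exact congrArg (fun L : E →L[ℝ] ℝ => L X) h4.mfderiv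

/-- The derivation cocycle `X ↦ -d X` of the Lie algebra of a simply connected group integrates to
a group cocycle. -/
theorem IsHarishChandraPair.exists_cocycle [FiniteDimensional ℝ E] [LieGroup 𝓘(ℝ, E) ∞ G]
    [SimplyConnectedSpace G] (hP : IsHarishChandraPair 𝔤.toGLieAlgebra ι α) :
    ∃ lam : G → V, (∀ g, lam g ∈ 𝔤.gr 1) ∧ (∀ g h : G, lam (g * h) = lam g + α g (lam h)) ∧
      ∀ X, HasDerivAtOne lam X (-𝔤.d (ι X)) := by
  have hfin := hP.finiteDimensional 1
  -- coordinates on the degree one part, which provide it with a norm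
  let n := Module.finrank ℝ (𝔤.gr 1)
  let e : 𝔤.gr 1 ≃ₗ[ℝ] (Fin n → ℝ) := (Module.finBasis ℝ (𝔤.gr 1)).equivFun
  obtain ⟨P, hPe⟩ := LinearMap.exists_extend e.toLinearMap
  let J : (Fin n → ℝ) →ₗ[ℝ] V := (𝔤.gr 1).subtype ∘ₗ e.symm.toLinearMap
  have hJ : ∀ w, J w ∈ 𝔤.gr 1 := fun w => (e.symm w).2
  have hPJ : ∀ w, P (J w) = w := fun w => by
    have := LinearMap.congr_fun hPe (e.symm w)
    exact this.trans (e.apply_symm_apply w)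
  have hJP : ∀ x ∈ 𝔤.gr 1, J (P x) = x := fun x hx => by
    have h1 : P x = e ⟨x, hx⟩ := LinearMap.congr_fun hPe ⟨x, hx⟩
    rw [h1]; simp [J]
  let A : G →* ((Fin n → ℝ) →L[ℝ] (Fin n → ℝ)) :=
    { toFun := fun g => LinearMap.toContinuousLinearMap (P ∘ₗ α g ∘ₗ J)
      map_one' := by
        ext1 w
        simp [hPJ]
      map_mul' := fun g h => by
        ext1 w
        change P (α (g * h) (J w)) = P (α g (J (P (α h (J w)))))
        rw [hJP _ (hP.map_mem h (hJ w)), map_mul, Module.End.mul_apply] }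
  let a : E →L[ℝ] (Fin n → ℝ) →L[ℝ] (Fin n → ℝ) := LinearMap.toContinuousLinearMap
    { toFun := fun X => LinearMap.toContinuousLinearMap (P ∘ₗ 𝔤.bracket (ι X) ∘ₗ J)
      map_add' := fun X Y => by
        ext1 w
        exact (congrArg (fun x => P (𝔤.bracket x (J w))) (ι.map_add X Y)).trans (by simp)
      map_smul' := fun r X => by
        ext1 w
        exact (congrArg (fun x => P (𝔤.bracket x (J w))) (ι.map_smul r X)).trans (by simp) }
  let c : E →L[ℝ] (Fin n → ℝ) :=
    LinearMap.toContinuousLinearMap (E := E) (-(P ∘ₗ 𝔤.d ∘ₗ ι : E →ₗ[ℝ] (Fin n → ℝ)))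
  have hA : ∀ X : GroupLieAlgebra 𝓘(ℝ, E) G, HasDerivAtOne A X (a X) := by
    intro X
    let M : Fin n → (Fin n → ℝ) →ₗ[ℝ] ((Fin n → ℝ) →L[ℝ] (Fin n → ℝ)) := fun i =>
      ((ContinuousLinearMap.smulRightL ℝ (Fin n → ℝ) (Fin n → ℝ)
        (ContinuousLinearMap.proj i)) : _ →L[ℝ] _).toLinearMap
    -- a matrix is the sum of its columns
    have hcol : ∀ T : V →ₗ[ℝ] V, LinearMap.toContinuousLinearMap (P ∘ₗ T ∘ₗ J) =
        ∑ i, (M i ∘ₗ P) (T (J (Pi.single i 1))) := by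
      intro T
      ext1 w
      rw [sum_apply]
      conv_lhs => rw [pi_eq_sum_univ' w]
      simp [M]
    have h1 := HasDerivAtOne.sum Finset.univ fun i : Fin n =>
      (hP.hasDerivAtOne X (J (Pi.single i 1))).map (M i ∘ₗ P)
    simp only [← hcol] at h1
    exact h1
  have hc : ∀ X Y : GroupLieAlgebra 𝓘(ℝ, E) G,
      c (⁅X, Y⁆ : GroupLieAlgebra 𝓘(ℝ, E) G) = a X (c Y) - a Y (c X) := by
    intro X Y
    change -P (𝔤.d (ι ⁅X, Y⁆)) = P (𝔤.bracket (ι X) (J (-P (𝔤.d (ι Y))))) -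
      P (𝔤.bracket (ι Y) (J (-P (𝔤.d (ι X)))))
    have h1 := 𝔤.antisymm (𝔤.d_mem (hP.ι_mem X)) (hP.ι_mem Y)
    rw [mul_zero, Int.negOnePow_zero, one_smul] at h1
    rw [hP.ι_bracket, 𝔤.d_bracket_of_mem_zero (hP.ι_mem X), h1, map_neg J, map_neg J,
      hJP _ (𝔤.d_mem (hP.ι_mem X)), hJP _ (𝔤.d_mem (hP.ι_mem Y))]
    simp only [map_neg, map_add]
    abel
  obtain ⟨hA1, hA2⟩ := HasDerivAtOne.hasMFDerivAt hA
  obtain ⟨lam, hs, hcoc, hd⟩ := exists_group_cocycle_of_lie_cocycle hA1 hA2 c hc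
  refine ⟨fun g => J (lam g), fun g => hJ _, fun g h => ?_, fun X => ?_⟩
  · change J (lam (g * h)) = J (lam g) + α g (J (lam h))
    rw [hcoc, map_add]
    congr 1
    exact hJP _ (hP.map_mem g (hJ _))
  · have h1 := (hd.hasDerivAtOne hs X).map J
    have h2 : J (c X) = -𝔤.d (ι X) := by
      change J (-P (𝔤.d (ι X))) = _
      rw [map_neg, hJP _ (𝔤.d_mem (hP.ι_mem X))]
    rwa [h2] at h1

variable {lam : G → V}

/-- Both sides of the condition on `ad (lam g)` are cocycles for the conjugation action of `G` on
linear maps, and they have the same derivative at the identity since `d` is a derivation. -/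
theorem IsHarishChandraPair.bracket_eq_of_cocycle [LieGroup 𝓘(ℝ, E) ∞ G] [ConnectedSpace G]
    (hP : IsHarishChandraPair 𝔤.toGLieAlgebra ι α)
    (hcoc : ∀ g h : G, lam (g * h) = lam g + α g (lam h))
    (hd : ∀ X, HasDerivAtOne (E := E) lam X (-𝔤.d (ι X))) (g : G) (x : V) :
    𝔤.bracket (lam g) x = α g (𝔤.d (α g⁻¹ x)) - 𝔤.d x := by
  let D : G → V → V := fun g x => 𝔤.bracket (lam g) x - α g (𝔤.d (α g⁻¹ x)) + 𝔤.d x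
  -- `D` is a cocycle for the conjugation action on linear maps
  have hD : ∀ g h x, D (g * h) x = D g x + α g (D h (α g⁻¹ x)) := by
    intro g h x
    simp only [D, hcoc, map_add, map_sub, LinearMap.add_apply, hP.map_bracket, mul_inv_rev,
      map_mul, Module.End.mul_apply, α.apply_inv_apply]
    abel
  have hder : ∀ X i, ∀ y ∈ 𝔤.gr i, HasDerivAtOne (E := E) (fun h => D h y) X 0 := by
    intro X i y hy
    have hfin := hP.finiteDimensional i
    have hmem : ∀ h : G, α h⁻¹ y ∈ 𝔤.gr i := fun h => hP.map_mem h⁻¹ hy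
    have hs : SmoothMap E fun h => α h⁻¹ y :=
      (hP.smooth y).comp_contMDiff (contMDiff_inv 𝓘(ℝ, E) ∞)
    obtain ⟨u', -, hu⟩ := hs.exists_hasDerivAtOne hmem X
    have h1 := HasDerivAtOne.apply (A := α) (A' := 𝔤.bracket (ι X))
      (fun z _ => hP.hasDerivAtOne X z) hu hmem
    simp only [α.apply_inv_apply] at h1
    have h2 := h1.unique (HasDerivAtOne.const y)
    have h3 := HasDerivAtOne.apply (A := fun h => α h ∘ₗ 𝔤.d) (A' := 𝔤.bracket (ι X) ∘ₗ 𝔤.d)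
      (fun z _ => hP.hasDerivAtOne X (𝔤.d z)) hu hmem
    have h4 := (((hd X).map (𝔤.bracket.flip y)).sub h3).add (HasDerivAtOne.const (𝔤.d y))
    simp only [map_one, Module.End.one_apply, inv_one, LinearMap.comp_apply] at h2 h4
    rw [eq_neg_of_add_eq_zero_left h2] at h4
    have h5 : 𝔤.bracket.flip y (-𝔤.d (ι X)) - (𝔤.d (-𝔤.bracket (ι X) y) +
        𝔤.bracket (ι X) (𝔤.d y)) + 0 = 0 := by
      rw [map_neg, map_neg, 𝔤.d_bracket_of_mem_zero (hP.ι_mem X), LinearMap.flip_apply]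
      abel
    rw [h5] at h4
    exact h4
  -- smoothness is available only on the finite-dimensional homogeneous components
  have hD0 : ∀ i, ∀ y ∈ 𝔤.gr i, ∀ g, D g y = 0 := by
    intro i y hy g
    have key := eq_one_of_hasDerivAtOne_mul_left_zero (E := E) (f := fun g => D g y)
      (fun g X => ?_) g
    · rw [key]
      simp [D, map_one_eq_zero_of_cocycle hcoc]
    · have h1 := (HasDerivAtOne.const (D g y)).add
        ((hder X i (α g⁻¹ y) (hP.map_mem _ hy)).map (α g))
      simp only [← hD] at h1
      simpa using h1
  have h : 𝔤.bracket (lam g) = α g ∘ₗ 𝔤.d ∘ₗ α g⁻¹ - 𝔤.d := by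
    refine 𝔤.isInternal.linearMap_ext fun i y hy => ?_
    have := hD0 i y hy g
    rw [← sub_eq_zero, ← this]
    simp only [D, LinearMap.sub_apply, LinearMap.comp_apply]
    abel
  exact LinearMap.congr_fun h x

/-- The Maurer-Cartan curvature `d (lam g) + ½ [lam g, lam g]` of a cocycle is again a cocycle, with
derivative `-d (d X) = 0` at the identity, so that it vanishes on a connected group. -/
theorem IsDGCocycle.maurerCartan [LieGroup 𝓘(ℝ, E) ∞ G] [ConnectedSpace G]
    (hP : IsHarishChandraPair 𝔤.toGLieAlgebra ι α) (hl : IsDGCocycle E 𝔤 α lam)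
    (hd : ∀ X, HasDerivAtOne (E := E) lam X (-𝔤.d (ι X))) (g : G) :
    𝔤.d (lam g) + (1 / 2 : ℝ) • 𝔤.bracket (lam g) (lam g) = 0 := by
  have hfin := hP.finiteDimensional 1
  have h1 := map_one_eq_zero_of_cocycle hl.cocycle
  let m : G → V := fun g => 𝔤.d (lam g) + (1 / 2 : ℝ) • 𝔤.bracket (lam g) (lam g)
  have hm : ∀ g h, m (g * h) = m g + α g (m h) := by
    intro g h
    have h2 := hl.bracket_eq g (α g (lam h))
    rw [α.inv_apply_apply] at h2
    have h3 := 𝔤.antisymm (hP.map_mem g (hl.mem h)) (hl.mem g)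
    rw [mul_one, Int.negOnePow_one, Units.neg_smul, one_smul, neg_neg] at h3
    simp only [m, hl.cocycle, map_add, map_smul, LinearMap.add_apply, h3, h2, hP.map_bracket]
    module
  have key := eq_one_of_hasDerivAtOne_mul_left_zero (E := E) (f := m) (fun g X => ?_) g
  · refine key.trans ?_
    simp [m, h1]
  · have h2 := HasDerivAtOne.apply (A := fun g => 𝔤.bracket (lam g))
      (A' := 𝔤.bracket (-𝔤.d (ι X))) (fun y _ => (hd X).map (𝔤.bracket.flip y)) (hd X) hl.mem
    have h3 := ((hd X).map 𝔤.d).add (h2.map ((1 / 2 : ℝ) • LinearMap.id))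
    have h4 := (HasDerivAtOne.const (m g)).add (h3.map (α g))
    simp only [hm]
    have h5 : (0 : V) + α g (𝔤.d (-𝔤.d (ι X)) + ((1 / 2 : ℝ) • (LinearMap.id : V →ₗ[ℝ] V))
        (𝔤.bracket (lam 1) (-𝔤.d (ι X)) + 𝔤.bracket (-𝔤.d (ι X)) (lam 1))) = 0 := by
      simp [h1, 𝔤.d_d]
    rw [h5] at h4
    exact h4

theorem IsHarishChandraPair.existsUnique_extension [FiniteDimensional ℝ E]
    [LieGroup 𝓘(ℝ, E) ∞ G] [SimplyConnectedSpace G] (hE : 𝔤.IsExtension 𝔥)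
    (hP : IsHarishChandraPair 𝔤.toGLieAlgebra ι α) :
    ∃! β : Representation ℝ G (V × ℝ), (∀ (g : G) (x : V), β g (x, 0) = (α g x, 0)) ∧
      IsHarishChandraPair 𝔥.toGLieAlgebra (LinearMap.inl ℝ V ℝ ∘ₗ ι) β := by
  obtain ⟨lam, hmem, hcoc, hd⟩ := hP.exists_cocycle
  have hl : IsDGCocycle E 𝔤 α lam :=
    ⟨hmem, (hd 0).1, hcoc, hP.bracket_eq_of_cocycle hcoc hd⟩
  refine ⟨α.extendByCocycle lam hcoc, ⟨(hl.isExtendedAction hE hP).restrict,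
    (hl.isHarishChandraPair_iff hE hP).2 ⟨hl.maurerCartan hP hd, fun X => (hd X).2⟩⟩, ?_⟩
  rintro β ⟨hr, hβ⟩
  exact hβ.eq_of_restrict hE hr (hl.isExtendedAction hE hP).restrict
    ((hl.isHarishChandraPair_iff hE hP).2 ⟨hl.maurerCartan hP hd, fun X => (hd X).2⟩)

end SimplyConnected

theorem mainTheorem10 :
    -- the canonical DGLA structure on `L ⊕ k∂`
    (∀ {k L : Type*} [Field k] [CharZero k] [AddCommGroup L] [Module k L] (𝔤 : DGLieAlgebra k L),
      𝔤.IsOuter → ∃! 𝔥 : DGLieAlgebra k (L × k), 𝔤.IsExtension 𝔥) ∧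
    (∀ {E G V : Type*} [NormedAddCommGroup E] [NormedSpace ℝ E] [FiniteDimensional ℝ E]
      [TopologicalSpace G] [ChartedSpace E G] [T2Space G] [SecondCountableTopology G] [Group G]
      [LieGroup 𝓘(ℝ, E) ∞ G] [AddCommGroup V] [Module ℝ V]
      (𝔤 : DGLieAlgebra ℝ V) (𝔥 : DGLieAlgebra ℝ (V × ℝ))
      (ι : GroupLieAlgebra 𝓘(ℝ, E) G →ₗ[ℝ] V) (α : Representation ℝ G V),
      𝔤.IsOuter → 𝔤.IsExtension 𝔥 → IsHarishChandraPair 𝔤.toGLieAlgebra ι α →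
      -- cocycles correspond to extensions of the action, via `β g ∂ = lam g + ∂`
      (∃ e : {lam : G → V // IsDGCocycle E 𝔤 α lam} ≃
          {β : Representation ℝ G (V × ℝ) //
            IsExtendedAction E 𝔥.toGLieAlgebra α β ∧ ∀ g : G, (β g (0, 1)).2 = 1},
        (∀ lam g, (e lam).1 g (0, 1) = (lam.1 g, 1)) ∧
        (∀ lam, (∀ (g : G) (a b : V × ℝ),
            (e lam).1 g (𝔥.bracket a b) = 𝔥.bracket ((e lam).1 g a) ((e lam).1 g b)) ↔
          ∀ g : G, 𝔤.d (lam.1 g) + (1 / 2 : ℝ) • 𝔤.bracket (lam.1 g) (lam.1 g) = 0) ∧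
        (∀ lam, IsHarishChandraPair 𝔥.toGLieAlgebra (LinearMap.inl ℝ V ℝ ∘ₗ ι) (e lam).1 ↔
          (∀ g : G, 𝔤.d (lam.1 g) + (1 / 2 : ℝ) • 𝔤.bracket (lam.1 g) (lam.1 g) = 0) ∧
          ∀ X : GroupLieAlgebra 𝓘(ℝ, E) G, DerivAtOneEq lam.1 X (-𝔤.d (ι X)))) ∧
      -- for connected `G` every extension acts trivially on `𝔥 / 𝔤`
      (ConnectedSpace G → ∀ β : Representation ℝ G (V × ℝ),
        IsExtendedAction E 𝔥.toGLieAlgebra α β → ∀ g : G, (β g (0, 1)).2 = 1) ∧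
      -- for simply connected `G` there is a canonical extended Harish-Chandra pair
      (SimplyConnectedSpace G → ∃! β : Representation ℝ G (V × ℝ),
        (∀ (g : G) (x : V), β g (x, 0) = (α g x, 0)) ∧
          IsHarishChandraPair 𝔥.toGLieAlgebra (LinearMap.inl ℝ V ℝ ∘ₗ ι) β)) := by
  refine ⟨fun 𝔤 _ => ⟨𝔤.ext, 𝔤.isExtension_ext, fun 𝔥 h => h.eq_ext⟩, ?_⟩
  intro E G V _ _ _ _ _ _ _ _ _ _ _ 𝔤 𝔥 ι α hO hE hP
  refine ⟨⟨cocycleEquivExtendedAction hE hP, fun lam g => ?_, fun lam => lam.2.map_bracket_iff hE hP,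
    fun lam => lam.2.isHarishChandraPair_iff hE hP⟩, fun _ β hβ g => ?_, fun _ =>
    hP.existsUnique_extension hE⟩
  · refine (α.extendByCocycle_apply lam.1 lam.2.cocycle g (0, 1)).trans ?_
    simp
  · exact Representation.snd_eq_one_of_hasDerivAtOne_zero (E := E) hβ.restrict
      (fun X => hβ.hasDerivAtOne_snd hO hE hP X) g
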